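/- Let $\mathcal H$ be a complex Hilbert space, let $T\in\boldsymbol B(\mathcal H)$ be a positive operator (that is, $\langle Th,h\rangle\ge 0$ for all $h\in\mathcal H$), and let $\alpha,\beta$ be two distinct positive real numbers. Let $F$ be a semispectral measure on the Borel subsets of $\mathbb R_+=[0,\infty)$ with values in $\boldsymbol B(\mathcal H)$ (that is, $\langle F(\cdot)h,h\rangle$ is a positive measure for every $h\in\mathcal H$, and $F(\mathbb R_+)=I_{\mathcal H}$), and assume that $F$ has compact support. For a Borel function $f\colon\mathbb R_+\to\mathbb C$ with $\int_{\mathbb R_+}|f(x)|\,\langle F(\mathrm dx)h,h\rangle<\infty$ for all $h\in\mathcal H$, the integral $\int_{\mathbb R_+}f\,\mathrm dF$ is the unique operator $S\in\boldsymbol B(\mathcal H)$ such that $\langle Sh,h\rangle=\int_{\mathbb R_+}f(x)\,\langle F(\mathrm dx)h,h\rangle$ for all $h\in\mathcal H$. For a real number $p\ge 0$, $T^p$ is given by the functional calculus of $T$, and $x^0=1$ for all $x\in\mathbb R_+$. Then the following conditions are equivalent: (i) $F$ is the spectral measure of $T$; that is, $F(\Delta)$ is an orthogonal projection for every Borel set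 $\Delta\subseteq\mathbb R_+$, and $T=\int_{\mathbb R_+}x\,F(\mathrm dx)$; (ii) $T^n=\int_{\mathbb R_+}x^n\,F(\mathrm dx)$ for all integers $n\ge 0$; (iii) $T^p=\int_{\mathbb R_+}x^p\,F(\mathrm dx)$ for all real $p\ge 0$; (iv) $T^p=\int_{\mathbb R_+}x^p\,F(\mathrm dx)$ for $p=\alpha$ and $p=\beta$. -/

import Mathlib

open MeasureTheory
open scoped NNReal ENNReal ComplexOrder

/-- A semispectral measure on a measurable space `X`, acting on a complex Hilbert space `H`:
an operator-valued set function `F` on the σ-algebra of `X` such that, for every `h`, the map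
`Δ ↦ ⟨F(Δ)h, h⟩` is a positive (countably additive) measure, and `F(X)` is the identity.
The values of `F` on non-measurable sets carry no meaning and are never used.
(The inner product of Mathlib is linear in its second argument, so `⟨F(Δ)h, h⟩` in the
convention "linear in the first argument" is `inner ℂ h (F Δ h)`.) -/
structure SemispectralMeasure (X : Type*) [MeasurableSpace X] (H : Type*)
    [NormedAddCommGroup H] [InnerProductSpace ℂ H] where
  /-- the operator attached to a set -/
  toFun : Set X → H →L[ℂ] H
  nonneg' : ∀ h : H, ∀ Δ : Set X, MeasurableSet Δ → 0 ≤ inner ℂ h (toFun Δ h)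
  hasSum_iUnion' : ∀ h : H, ∀ Δ : ℕ → Set X, (∀ i, MeasurableSet (Δ i)) →
    Pairwise (fun i j => Disjoint (Δ i) (Δ j)) →
      HasSum (fun i => inner ℂ h (toFun (Δ i) h)) (inner ℂ h (toFun (⋃ i, Δ i) h))
  univ' : toFun Set.univ = 1

namespace SemispectralMeasure

instance {X : Type*} [MeasurableSpace X] {H : Type*} [NormedAddCommGroup H]
    [InnerProductSpace ℂ H] :
    CoeFun (SemispectralMeasure X H) (fun _ => Set X → H →L[ℂ] H) :=
  ⟨SemispectralMeasure.toFun⟩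

/-- The positive measure `⟨F(·)h, h⟩`. -/
noncomputable def diag {X : Type*} [MeasurableSpace X] {H : Type*} [NormedAddCommGroup H]
    [InnerProductSpace ℂ H] (F : SemispectralMeasure X H) (h : H) : Measure X :=
  Measure.ofMeasurable (fun Δ _ => ENNReal.ofReal (inner ℂ h (F Δ h)).re)
    (by
      have h0 := (F.hasSum_iUnion' h (fun _ => ∅) (fun _ => MeasurableSet.empty)
        (fun _ _ _ => disjoint_bot_left)).summable
      rw [summable_const_iff] at h0
      simp [h0])
    (by
      intro Δ hΔ hd
      have hs := Complex.hasSum_re (F.hasSum_iUnion' h Δ hΔ hd)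
      have hn : ∀ i, 0 ≤ (inner ℂ h (F (Δ i) h)).re := fun i =>
        (Complex.nonneg_iff.mp (F.nonneg' h (Δ i) (hΔ i))).1
      rw [← hs.tsum_eq, ENNReal.ofReal_tsum_of_nonneg hn hs.summable])

theorem diag_apply {X : Type*} [MeasurableSpace X] {H : Type*} [NormedAddCommGroup H]
    [InnerProductSpace ℂ H] (F : SemispectralMeasure X H) (h : H) {Δ : Set X}
    (hΔ : MeasurableSet Δ) : F.diag h Δ = ENNReal.ofReal (inner ℂ h (F Δ h)).re :=
  Measure.ofMeasurable_apply Δ hΔ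

/-- `f ∈ L¹(F)`: `f` is measurable and `∫ |f| d⟨F(·)h, h⟩ < ∞` for every `h`. -/
def IsL1 {X : Type*} [MeasurableSpace X] {H : Type*} [NormedAddCommGroup H]
    [InnerProductSpace ℂ H] (F : SemispectralMeasure X H) (f : X → ℂ) : Prop :=
  Measurable f ∧ ∀ h : H, ∫⁻ x, ‖f x‖ₑ ∂(F.diag h) < ∞

/-- `F.HasIntegral f S` says that `S = ∫ f dF`: the function `f` belongs to `L¹(F)`, and `S` is
the (unique, see `HasIntegral.unique`) bounded operator with
`⟨S h, h⟩ = ∫ f(x) ⟨F(dx)h, h⟩` for every `h`. -/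
def HasIntegral {X : Type*} [MeasurableSpace X] {H : Type*} [NormedAddCommGroup H]
    [InnerProductSpace ℂ H] (F : SemispectralMeasure X H) (f : X → ℂ) (S : H →L[ℂ] H) : Prop :=
  F.IsL1 f ∧ ∀ h : H, inner ℂ h (S h) = ∫ x, f x ∂(F.diag h)

theorem HasIntegral.unique {X : Type*} [MeasurableSpace X] {H : Type*} [NormedAddCommGroup H]
    [InnerProductSpace ℂ H] {F : SemispectralMeasure X H} {f : X → ℂ} {S S' : H →L[ℂ] H}
    (hS : F.HasIntegral f S) (hS' : F.HasIntegral f S') : S = S' := by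
  have key : (S : H →ₗ[ℂ] H) = S' := by
    rw [← ext_inner_map]
    intro h
    have e : inner ℂ h (S h) = inner ℂ h (S' h) := by rw [hS.2, hS'.2]
    have e' := congrArg (starRingEnd ℂ) e
    rw [inner_conj_symm, inner_conj_symm] at e'
    exact e'
  ext h
  exact LinearMap.congr_fun key h

/-- A semispectral measure `F` on `ℝ₊` has compact support: it vanishes off some compact set
(equivalently, as `ℝ₊` is second countable, its closed support is compact). -/
def HasCompactSupport {H : Type*} [NormedAddCommGroup H] [InnerProductSpace ℂ H]
    (F : SemispectralMeasure ℝ≥0 H) : Prop :=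
  ∃ K : Set ℝ≥0, IsCompact K ∧ F Kᶜ = 0

/-- `F` is a spectral measure: all its values are orthogonal projections. -/
def IsSpectral {X : Type*} [MeasurableSpace X] {H : Type*} [NormedAddCommGroup H]
    [InnerProductSpace ℂ H] [CompleteSpace H] (F : SemispectralMeasure X H) : Prop :=
  ∀ Δ : Set X, MeasurableSet Δ → IsStarProjection (F Δ)

/-- `F`, defined on the Borel sets of `ℝ₊`, is the spectral measure of `T`: it is a spectral
measure and `T = ∫ x dF`. -/
def IsSpectralMeasureOf {H : Type*} [NormedAddCommGroup H] [InnerProductSpace ℂ H]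
    [CompleteSpace H] (F : SemispectralMeasure ℝ≥0 H) (T : H →L[ℂ] H) : Prop :=
  F.IsSpectral ∧ F.HasIntegral (fun x => ((x : ℝ) : ℂ)) T

end SemispectralMeasure

/-! The substantial implication is (iv) → (i). Let `α < β` be the two exponents and replace `F` by
its image `G` under `x ↦ x ^ β` and `T` by `B = T ^ β`. The two moments then have exponents `1` and
`s = α / β ∈ (0, 1)`.

For `t > 0` the operator Jensen inequality reads `(t + B)⁻¹ ≤ ∫ (t + x)⁻¹ dG`. It is the Schur
complement of a positive Gram matrix, and uses only the first moment. Now `x ^ s` is, up to a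
positive constant, `∫₀^∞ (t ^ (s - 1) - t ^ s (t + x)⁻¹) dt`. Integrating Jensen in `t` therefore
compares the `s`-th moment with `B ^ s`. As these agree, equality holds for almost every `t`
(`ae_integral_inv_eq`), and by monotonicity in `t` also at `t = 1` (`op_inv_one_add_eq`).

Enlarging the Gram matrix by an arbitrary bounded `f` shows that equality in Jensen forces `∫ f x dG
= (∫ f dG) B` (`op_mul_inv_of_op_inv_eq`, `op_mul_coe_of_op_inv_eq`). This spreads to powers, to
continuous functions by Weierstrass and to Borel indicators by a π-λ argument, so `G(Δ)² = G(Δ)`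
(`isSpectral_of_op_mul`). Undoing the change of variable gives (i).

For (i) → (ii), integration against a spectral measure is multiplicative; (ii) → (iii) is
Weierstrass approximation. -/

open Filter Topology

/-! ### Polarization and weak limits of quadratic forms. -/

section WeakLimits

variable {H : Type*} [NormedAddCommGroup H] [InnerProductSpace ℂ H]

/-- The polarization of a function `q` on a complex vector space; it recovers `inner ℂ h (S k)`
from `q h = inner ℂ h (S h)`. -/
noncomputable def polarForm (q : H → ℂ) (h k : H) : ℂ :=
  (q (h + k) - q (h - k) - Complex.I * q (h + Complex.I • k)
    + Complex.I * q (h - Complex.I • k)) / 4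

theorem polarForm_inner (S : H →L[ℂ] H) (h k : H) :
    polarForm (fun v => inner ℂ v (S v)) h k = inner ℂ h (S k) := by
  simp only [polarForm, map_add, map_sub, map_smul, inner_add_left, inner_add_right,
    inner_sub_left, inner_sub_right, inner_smul_left, inner_smul_right, Complex.conj_I]
  ring_nf
  simp only [Complex.I_sq]
  ring

theorem tendsto_inner_polarForm {ι : Type*} {l : Filter ι} {S : ι → H →L[ℂ] H} {q : H → ℂ}
    (hq : ∀ h, Tendsto (fun i => inner ℂ h (S i h)) l (𝓝 (q h))) (h k : H) :
    Tendsto (fun i => inner ℂ h (S i k)) l (𝓝 (polarForm q h k)) := by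
  have e : (fun i => inner ℂ h (S i k)) =
      fun i => polarForm (fun v => inner ℂ v (S i v)) h k :=
    funext fun i => (polarForm_inner (S i) h k).symm
  rw [e]
  unfold polarForm
  exact ((((hq _).sub (hq _)).sub ((hq _).const_mul _)).add ((hq _).const_mul _)).div_const _

theorem tendsto_inner_of_tendsto_inner_self {ι : Type*} {l : Filter ι} {S : ι → H →L[ℂ] H}
    {T : H →L[ℂ] H} (hq : ∀ h, Tendsto (fun i => inner ℂ h (S i h)) l (𝓝 (inner ℂ h (T h))))
    (h k : H) : Tendsto (fun i => inner ℂ h (S i k)) l (𝓝 (inner ℂ h (T k))) := by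
  rw [← polarForm_inner T]
  exact tendsto_inner_polarForm hq h k

theorem ext_inner_self {S T : H →L[ℂ] H} (h : ∀ v, inner ℂ v (S v) = inner ℂ v (T v)) :
    S = T := by
  ext k
  refine ext_inner_left ℂ fun v => ?_
  rw [← polarForm_inner S, ← polarForm_inner T, funext h]

/-- Each of the four arguments of `q` has norm at most `‖h‖ + ‖k‖`; no parallelogram law is needed.
-/
theorem norm_polarForm_le {q : H → ℂ} {M : ℝ} (hM : ∀ h, ‖q h‖ ≤ M * ‖h‖ ^ 2) (h k : H) :
    ‖polarForm q h k‖ ≤ M * (‖h‖ + ‖k‖) ^ 2 := by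
  -- The sign of `M` is not assumed: any nonzero vector forces `0 ≤ M`, and if `h = k = 0` the bound
  -- is zero on both sides.
  have hM0 : ∀ v : H, ‖v‖ ≤ ‖h‖ + ‖k‖ → ‖q v‖ ≤ M * (‖h‖ + ‖k‖) ^ 2 := by
    intro v hv
    rcases eq_or_ne v 0 with rfl | hv0
    · have h0 : ‖q 0‖ ≤ 0 := by simpa using hM 0
      by_cases hz : ‖h‖ + ‖k‖ = 0
      · simpa [hz] using h0
      · have : 0 ≤ M := by
          rcases eq_or_ne h 0 with rfl | hh
          · have hk : k ≠ 0 := by rintro rfl; simp at hz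
            have := (norm_nonneg _).trans (hM k)
            exact nonneg_of_mul_nonneg_left this (by positivity)
          · have := (norm_nonneg _).trans (hM h)
            exact nonneg_of_mul_nonneg_left this (by positivity)
        exact h0.trans (by positivity)
    · have hMp : 0 ≤ M := by
        have := (norm_nonneg _).trans (hM v)
        exact nonneg_of_mul_nonneg_left this (by positivity)
      exact (hM v).trans (by gcongr)
  have e1 := hM0 (h + k) (norm_add_le _ _)
  have e2 := hM0 (h - k) (norm_sub_le _ _)
  have e3 := hM0 (h + Complex.I • k) (by simpa [norm_smul] using norm_add_le h (Complex.I • k))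
  have e4 := hM0 (h - Complex.I • k) (by simpa [norm_smul] using norm_sub_le h (Complex.I • k))
  have : ‖q (h + k) - q (h - k) - Complex.I * q (h + Complex.I • k)
      + Complex.I * q (h - Complex.I • k)‖ ≤ 4 * (M * (‖h‖ + ‖k‖) ^ 2) := by
    refine (norm_add_le _ _).trans ?_
    have f1 := norm_sub_le (q (h + k) - q (h - k)) (Complex.I * q (h + Complex.I • k))
    have f2 := norm_sub_le (q (h + k)) (q (h - k))
    simp only [norm_mul, Complex.norm_I, one_mul] at f1 ⊢
    linarith
  rw [polarForm, norm_div]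
  norm_num
  linarith

/-- A pointwise limit of quadratic forms of bounded operators that is a bounded quadratic form is
the quadratic form of a bounded operator. -/
theorem exists_operator_of_tendsto [CompleteSpace H] {S : ℕ → H →L[ℂ] H} {q : H → ℂ} {M : ℝ}
    (hq : ∀ h, Tendsto (fun i => inner ℂ h (S i h)) atTop (𝓝 (q h)))
    (hM : ∀ h, ‖q h‖ ≤ M * ‖h‖ ^ 2) : ∃ T : H →L[ℂ] H, ∀ h, inner ℂ h (T h) = q h := by
  have key := tendsto_inner_polarForm hq
  -- Sesquilinearity is inherited from the forms of the `S i` by uniqueness of limits.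
  let b : H →ₗ⋆[ℂ] H →ₗ[ℂ] ℂ := LinearMap.mk₂'ₛₗ (starRingEnd ℂ) (RingHom.id ℂ) (polarForm q)
    (fun m₁ m₂ n => tendsto_nhds_unique (key _ _) (by
      simpa only [inner_add_left] using (key m₁ n).add (key m₂ n)))
    (fun c m n => tendsto_nhds_unique (key _ _) (by
      simpa only [inner_smul_left, smul_eq_mul] using (key m n).const_mul (starRingEnd ℂ c)))
    (fun m n₁ n₂ => tendsto_nhds_unique (key _ _) (by
      simpa only [inner_add_right, map_add] using (key m n₁).add (key m n₂)))
    (fun c m n => tendsto_nhds_unique (key _ _) (by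
      simpa only [inner_smul_right, map_smul, smul_eq_mul, RingHom.id_apply]
        using (key m n).const_mul c))
  have hb : ∀ h k, ‖b h k‖ ≤ 4 * M * ‖h‖ * ‖k‖ := by
    intro h k
    rcases eq_or_ne h 0 with rfl | hh
    · simp
    rcases eq_or_ne k 0 with rfl | hk
    · simp
    have h1 : ‖h‖ ≠ 0 := norm_ne_zero_iff.mpr hh
    have k1 : ‖k‖ ≠ 0 := norm_ne_zero_iff.mpr hk
    -- Normalizing to unit vectors turns `M * (‖h‖ + ‖k‖) ^ 2` into the constant `4 * M`.
    have e := norm_polarForm_le hM (((‖h‖ : ℂ))⁻¹ • h) (((‖k‖ : ℂ))⁻¹ • k)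
    change ‖b (((‖h‖ : ℂ))⁻¹ • h) (((‖k‖ : ℂ))⁻¹ • k)‖ ≤ _ at e
    simp only [LinearMap.map_smulₛₗ, LinearMap.smul_apply, norm_smul, map_inv₀, Complex.conj_ofReal,
      norm_inv, Complex.norm_real, norm_norm, inv_mul_cancel₀ h1, inv_mul_cancel₀ k1,
      RingHom.id_apply] at e
    have hp : 0 < ‖h‖ := by positivity
    have kp : 0 < ‖k‖ := by positivity
    have e' : ‖b h k‖ = ‖h‖ * ‖k‖ * (‖k‖⁻¹ * (‖h‖⁻¹ * ‖b h k‖)) := by field_simp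
    rw [e']
    calc _ ≤ ‖h‖ * ‖k‖ * (M * (1 + 1) ^ 2) := by
          refine mul_le_mul_of_nonneg_left ?_ (by positivity)
          linarith
      _ = _ := by ring
  let B := b.mkContinuous₂ (4 * M) hb
  refine ⟨ContinuousLinearMap.adjoint (InnerProductSpace.continuousLinearMapOfBilin B),
    fun h => ?_⟩
  rw [ContinuousLinearMap.adjoint_inner_right,
    InnerProductSpace.continuousLinearMapOfBilin_apply]
  exact tendsto_nhds_unique (key h h) (hq h)

end WeakLimits

/-! ### Operator integrals of essentially bounded real functions. -/

namespace SemispectralMeasure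

variable {X : Type*} [MeasurableSpace X] {H : Type*} [NormedAddCommGroup H]
  [InnerProductSpace ℂ H]

theorem diag_univ (F : SemispectralMeasure X H) (h : H) :
    F.diag h Set.univ = ENNReal.ofReal (‖h‖ ^ 2) := by
  rw [F.diag_apply h MeasurableSet.univ, F.univ', one_apply_eq_self,
    inner_self_eq_norm_sq_to_K]
  congr 1
  norm_cast

instance (F : SemispectralMeasure X H) (h : H) : IsFiniteMeasure (F.diag h) :=
  ⟨by rw [diag_univ]; exact ENNReal.ofReal_lt_top⟩

theorem inner_apply_self (F : SemispectralMeasure X H) (h : H) {Δ : Set X}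
    (hΔ : MeasurableSet Δ) : inner ℂ h (F Δ h) = (((F.diag h).real Δ : ℝ) : ℂ) := by
  have h0 := Complex.nonneg_iff.mp (F.nonneg' h Δ hΔ)
  rw [Measure.real, F.diag_apply h hΔ, ENNReal.toReal_ofReal h0.1]
  exact Complex.ext rfl h0.2.symm

/-- Real-valued measurable functions that are essentially bounded with respect to `F`. -/
def IsBdd (F : SemispectralMeasure X H) (f : X → ℝ) : Prop :=
  Measurable f ∧ ∃ M : ℝ, ∀ h, ∀ᵐ x ∂F.diag h, |f x| ≤ M

variable {F : SemispectralMeasure X H} {f g : X → ℝ}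

theorem isBdd_of_forall_le {M : ℝ} (hf : Measurable f) (hM : ∀ x, |f x| ≤ M) : F.IsBdd f :=
  ⟨hf, M, fun _ => ae_of_all _ hM⟩

theorem isBdd_const (c : ℝ) : F.IsBdd fun _ => c :=
  isBdd_of_forall_le measurable_const fun _ => le_rfl

theorem isBdd_indicator {Δ : Set X} (hΔ : MeasurableSet Δ) :
    F.IsBdd (Δ.indicator fun _ => 1) :=
  isBdd_of_forall_le (M := 1) (measurable_const.indicator hΔ) fun x => by
    by_cases hx : x ∈ Δ <;> simp [hx]

theorem IsBdd.add (hf : F.IsBdd f) (hg : F.IsBdd g) : F.IsBdd fun x => f x + g x := by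
  obtain ⟨hf, M, hM⟩ := hf
  obtain ⟨hg, N, hN⟩ := hg
  refine ⟨hf.add hg, M + N, fun h => ?_⟩
  filter_upwards [hM h, hN h] with x h1 h2 using (abs_add_le _ _).trans (add_le_add h1 h2)

theorem IsBdd.mul (hf : F.IsBdd f) (hg : F.IsBdd g) : F.IsBdd fun x => f x * g x := by
  obtain ⟨hf, M, hM⟩ := hf
  obtain ⟨hg, N, hN⟩ := hg
  refine ⟨hf.mul hg, M * N, fun h => ?_⟩
  filter_upwards [hM h, hN h] with x h1 h2
  rw [abs_mul]
  exact mul_le_mul h1 h2 (abs_nonneg _) ((abs_nonneg _).trans h1)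

theorem IsBdd.const_mul (hf : F.IsBdd f) (c : ℝ) : F.IsBdd fun x => c * f x :=
  (isBdd_const c).mul hf

theorem IsBdd.pow (hf : F.IsBdd f) (n : ℕ) : F.IsBdd fun x => f x ^ n := by
  induction n with
  | zero => simpa using isBdd_const (F := F) 1
  | succ n ih => simpa only [pow_succ] using ih.mul hf

theorem isBdd_simpleFunc (s : SimpleFunc X ℝ) : F.IsBdd s := by
  obtain ⟨C, hC⟩ := s.exists_forall_norm_le
  exact isBdd_of_forall_le s.measurable hC

theorem IsBdd.integrable (hf : F.IsBdd f) (h : H) : Integrable f (F.diag h) := by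
  obtain ⟨hf, M, hM⟩ := hf
  exact Integrable.of_bound hf.aestronglyMeasurable M (hM h)

theorem IsBdd.norm_integral_le (hf : F.IsBdd f) :
    ∃ M : ℝ, ∀ h, ‖((∫ x, f x ∂F.diag h : ℝ) : ℂ)‖ ≤ M * ‖h‖ ^ 2 := by
  obtain ⟨hf, M, hM⟩ := hf
  refine ⟨M, fun h => ?_⟩
  have := norm_integral_le_of_norm_le_const (f := f) (hM h)
  rwa [Measure.real, diag_univ, ENNReal.toReal_ofReal (by positivity),
    ← Complex.norm_real] at this

variable (F) in
theorem exists_op_simpleFunc (s : SimpleFunc X ℝ) :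
    ∃ S : H →L[ℂ] H, ∀ h, inner ℂ h (S h) = ((∫ x, s x ∂F.diag h : ℝ) : ℂ) := by
  refine ⟨∑ z ∈ s.range, (z : ℂ) • F (s ⁻¹' {z}), fun h => ?_⟩
  rw [s.integral_eq_sum ((isBdd_simpleFunc s).integrable h)]
  simp only [sum_apply, smul_apply, inner_sum,
    inner_smul_right, F.inner_apply_self h (s.measurableSet_fiber _), Complex.ofReal_sum,
    smul_eq_mul, Complex.ofReal_mul, mul_comm]

theorem tendsto_integral_approxOn (hf : F.IsBdd f) (h : H) :
    Tendsto (fun n => ∫ x, SimpleFunc.approxOn f hf.1 Set.univ 0 (Set.mem_univ _) n x ∂F.diag h)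
      atTop (𝓝 (∫ x, f x ∂F.diag h)) := by
  refine tendsto_integral_of_dominated_convergence (fun x => ‖f x‖ + ‖f x‖)
    (fun n => (SimpleFunc.measurable _).aestronglyMeasurable)
    ((hf.integrable h).norm.add (hf.integrable h).norm)
    (fun n => ae_of_all _ fun x => SimpleFunc.norm_approxOn_zero_le hf.1 (Set.mem_univ _) x n)
    (ae_of_all _ fun x => SimpleFunc.tendsto_approxOn hf.1 (Set.mem_univ _) (by simp))

variable [CompleteSpace H]

theorem IsBdd.exists_op (hf : F.IsBdd f) :
    ∃ S : H →L[ℂ] H, ∀ h, inner ℂ h (S h) = ((∫ x, f x ∂F.diag h : ℝ) : ℂ) := by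
  obtain ⟨M, hM⟩ := hf.norm_integral_le
  choose S hS using fun n => exists_op_simpleFunc F
    (SimpleFunc.approxOn f hf.1 Set.univ 0 (Set.mem_univ _) n)
  refine exists_operator_of_tendsto (S := S) (fun h => ?_) hM
  simp_rw [hS]
  exact (Complex.continuous_ofReal.tendsto _).comp (tendsto_integral_approxOn hf h)

open Classical in
variable (F) in
/-- The operator `∫ f dF`, for an essentially bounded real function `f`. -/
noncomputable def op (f : X → ℝ) : H →L[ℂ] H :=
  if hf : F.IsBdd f then hf.exists_op.choose else 0

theorem IsBdd.inner_op (hf : F.IsBdd f) (h : H) :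
    inner ℂ h (F.op f h) = ((∫ x, f x ∂F.diag h : ℝ) : ℂ) := by
  rw [op, dif_pos hf]
  exact hf.exists_op.choose_spec h

theorem IsBdd.op_eq (hf : F.IsBdd f) {S : H →L[ℂ] H}
    (hS : ∀ h, inner ℂ h (S h) = ((∫ x, f x ∂F.diag h : ℝ) : ℂ)) : F.op f = S :=
  ext_inner_self fun h => by rw [hf.inner_op, hS]

theorem IsBdd.op_add (hf : F.IsBdd f) (hg : F.IsBdd g) :
    F.op (fun x => f x + g x) = F.op f + F.op g :=
  (hf.add hg).op_eq fun h => by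
    rw [add_apply, inner_add_right, hf.inner_op, hg.inner_op,
      integral_add (hf.integrable h) (hg.integrable h), Complex.ofReal_add]

theorem IsBdd.op_const_mul (hf : F.IsBdd f) (c : ℝ) :
    F.op (fun x => c * f x) = (c : ℂ) • F.op f :=
  (hf.const_mul c).op_eq fun h => by
    rw [smul_apply, inner_smul_right, hf.inner_op, integral_const_mul,
      Complex.ofReal_mul]

theorem op_indicator {Δ : Set X} (hΔ : MeasurableSet Δ) :
    F.op (Δ.indicator fun _ => 1) = F Δ :=
  (isBdd_indicator hΔ).op_eq fun h => by
    rw [integral_indicator_const _ hΔ, F.inner_apply_self h hΔ, smul_eq_mul, mul_one]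

theorem apply_union {Δ Δ' : Set X} (hΔ : MeasurableSet Δ) (hΔ' : MeasurableSet Δ')
    (hd : Disjoint Δ Δ') : F (Δ ∪ Δ') = F Δ + F Δ' := by
  rw [← op_indicator hΔ, ← op_indicator hΔ', ← op_indicator (hΔ.union hΔ'),
    ← (isBdd_indicator hΔ).op_add (isBdd_indicator hΔ'), Set.indicator_union_of_disjoint hd]

theorem op_one : F.op (fun _ => 1) = 1 := by
  simpa [F.univ'] using op_indicator (F := F) MeasurableSet.univ

theorem op_const (c : ℝ) : F.op (fun _ => c) = (c : ℂ) • 1 := by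
  simpa [op_one] using (isBdd_const (F := F) 1).op_const_mul c

theorem IsBdd.inner_op_left (hf : F.IsBdd f) (h k : H) :
    inner ℂ (F.op f h) k = inner ℂ h (F.op f k) := by
  have : IsSelfAdjoint (F.op f) := by
    rw [isSelfAdjoint_iff, ContinuousLinearMap.star_eq_adjoint]
    refine ext_inner_self fun v => ?_
    rw [ContinuousLinearMap.adjoint_inner_right, ← inner_conj_symm, hf.inner_op,
      Complex.conj_ofReal]
  rw [← ContinuousLinearMap.adjoint_inner_right, this.adjoint_eq]

theorem IsBdd.isSelfAdjoint_op (hf : F.IsBdd f) : IsSelfAdjoint (F.op f) := by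
  rw [ContinuousLinearMap.isSelfAdjoint_iff_isSymmetric]
  exact hf.inner_op_left

theorem IsBdd.hasIntegral_iff (hf : F.IsBdd f) {S : H →L[ℂ] H} :
    F.HasIntegral (fun x => (f x : ℂ)) S ↔ F.op f = S := by
  constructor
  · exact fun hS => hf.op_eq fun h => by rw [hS.2 h, integral_complex_ofReal]
  · rintro rfl
    refine ⟨⟨Complex.measurable_ofReal.comp hf.1, fun h => ?_⟩, fun h => ?_⟩
    · exact (hf.integrable h).ofReal.2
    · rw [hf.inner_op, integral_complex_ofReal]

/-- Dominated convergence for operator integrals, in the weak operator topology. -/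
theorem tendsto_inner_op {f : ℕ → X → ℝ} {M : ℝ} (hf : ∀ n, F.IsBdd (f n)) (hg : F.IsBdd g)
    (hM : ∀ h, ∀ n, ∀ᵐ x ∂F.diag h, |f n x| ≤ M)
    (hlim : ∀ h, ∀ᵐ x ∂F.diag h, Tendsto (fun n => f n x) atTop (𝓝 (g x))) (h k : H) :
    Tendsto (fun n => inner ℂ h (F.op (f n) k)) atTop (𝓝 (inner ℂ h (F.op g k))) := by
  refine tendsto_inner_of_tendsto_inner_self (fun h => ?_) h k
  simp_rw [(hf _).inner_op, hg.inner_op]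
  refine (Complex.continuous_ofReal.tendsto _).comp ?_
  exact tendsto_integral_of_dominated_convergence (fun _ => M)
    (fun n => (hf n).1.aestronglyMeasurable) (integrable_const _) (hM h) (hlim h)

end SemispectralMeasure

/-! ### Multiplicativity for spectral measures, and complete positivity. -/

namespace SemispectralMeasure

variable {X : Type*} [MeasurableSpace X] {H : Type*} [NormedAddCommGroup H]
  [InnerProductSpace ℂ H] {F : SemispectralMeasure X H} {f g : X → ℝ}

/-- To prove a property of all essentially bounded functions, it suffices to check it on
indicators, and to show that it is stable under linear combinations and bounded pointwise
limits. -/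
theorem IsBdd.induction {P : (X → ℝ) → Prop}
    (indicator : ∀ Δ, MeasurableSet Δ → P (Δ.indicator fun _ => 1))
    (const_mul : ∀ (c : ℝ) (f : X → ℝ), F.IsBdd f → P f → P fun x => c * f x)
    (add : ∀ f g : X → ℝ, F.IsBdd f → F.IsBdd g → P f → P g → P fun x => f x + g x)
    (limit : ∀ (f : ℕ → X → ℝ) (g : X → ℝ) (M : ℝ), (∀ n, F.IsBdd (f n)) → F.IsBdd g →
      (∀ h, ∀ n, ∀ᵐ x ∂F.diag h, |f n x| ≤ M) →
      (∀ h, ∀ᵐ x ∂F.diag h, Tendsto (fun n => f n x) atTop (𝓝 (g x))) → (∀ n, P (f n)) → P g)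
    (hf : F.IsBdd f) : P f := by
  have simple : ∀ s : SimpleFunc X ℝ, P s := by
    intro s
    induction s using SimpleFunc.induction with
    | @const c Δ hΔ =>
      convert const_mul c _ (isBdd_indicator hΔ) (indicator Δ hΔ) using 1
      ext x
      by_cases hx : x ∈ Δ <;> simp [hx]
    | @add s t _ hs ht => exact add s t (isBdd_simpleFunc s) (isBdd_simpleFunc t) hs ht
  -- The approximants based at `0` are bounded by `‖f x‖ + ‖f x‖`, whence the bound `M + M`.
  obtain ⟨M, hM⟩ := hf.2
  refine limit (fun n => SimpleFunc.approxOn f hf.1 Set.univ 0 (Set.mem_univ _) n) f (M + M)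
    (fun n => isBdd_simpleFunc _) hf (fun h n => ?_) (fun h => ae_of_all _ fun x =>
      SimpleFunc.tendsto_approxOn hf.1 (Set.mem_univ _) (by simp)) (fun n => simple _)
  filter_upwards [hM h] with x hx
  exact (SimpleFunc.norm_approxOn_zero_le hf.1 (Set.mem_univ _) x n).trans (add_le_add hx hx)

variable [CompleteSpace H]

/-- Weak convergence is enough because the fixed factor `F.op f` is self-adjoint and can be moved to
the other side of the inner product. -/
theorem op_mul_of_tendsto {f : X → ℝ} {g' : ℕ → X → ℝ} {M : ℝ} (hf : F.IsBdd f)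
    (hg' : ∀ n, F.IsBdd (g' n)) (hg : F.IsBdd g)
    (hM : ∀ h, ∀ n, ∀ᵐ x ∂F.diag h, |g' n x| ≤ M)
    (hlim : ∀ h, ∀ᵐ x ∂F.diag h, Tendsto (fun n => g' n x) atTop (𝓝 (g x)))
    (hmul : ∀ n, F.op (fun x => f x * g' n x) = F.op f * F.op (g' n)) :
    F.op (fun x => f x * g x) = F.op f * F.op g := by
  obtain ⟨N, hN⟩ := hf.2
  ext k
  refine ext_inner_left ℂ fun h => ?_
  have h1 : Tendsto (fun n => inner ℂ h (F.op (fun x => f x * g' n x) k)) atTop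
      (𝓝 (inner ℂ h (F.op (fun x => f x * g x) k))) := by
    refine tendsto_inner_op (M := N * M) (fun n => hf.mul (hg' n)) (hf.mul hg) (fun h n => ?_)
      (fun h => ?_) h k
    · filter_upwards [hM h n, hN h] with x h1 h2
      rw [abs_mul]
      exact mul_le_mul h2 h1 (abs_nonneg _) ((abs_nonneg _).trans h2)
    · filter_upwards [hlim h] with x hx using hx.const_mul _
  have h2 := tendsto_inner_op hg' hg hM hlim (F.op f h) k
  simp_rw [hf.inner_op_left] at h2
  simp_rw [hmul] at h1
  exact tendsto_nhds_unique h1 h2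

theorem op_mul_of_indicator {f : X → ℝ} (hf : F.IsBdd f)
    (hind : ∀ Δ, MeasurableSet Δ →
      F.op (fun x => f x * Δ.indicator (fun _ => 1) x) = F.op f * F Δ) (hg : F.IsBdd g) :
    F.op (fun x => f x * g x) = F.op f * F.op g := by
  refine IsBdd.induction (F := F) (P := fun g => F.op (fun x => f x * g x) = F.op f * F.op g)
    (fun Δ hΔ => ?_) (fun c g hg ih => ?_) (fun g₁ g₂ h₁ h₂ e₁ e₂ => ?_)
    (fun g' g M hg' hg hM hlim ih => op_mul_of_tendsto hf hg' hg hM hlim ih) hg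
  · rw [op_indicator hΔ, hind Δ hΔ]
  · have e : (fun x => f x * (c * g x)) = fun x => c * (f x * g x) := by ext x; ring
    rw [e, (hf.mul hg).op_const_mul, hg.op_const_mul, ih, mul_smul_comm]
  · simp_rw [mul_add]
    rw [(hf.mul h₁).op_add (hf.mul h₂), h₁.op_add h₂, e₁, e₂, mul_add]

/-- The extension from indicators works in the right factor only, so it is applied twice, with
adjoints taken in between to exchange the factors. -/
theorem op_mul_of_inter
    (hF : ∀ Δ Δ', MeasurableSet Δ → MeasurableSet Δ' → F (Δ ∩ Δ') = F Δ * F Δ')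
    (hf : F.IsBdd f) (hg : F.IsBdd g) : F.op (fun x => f x * g x) = F.op f * F.op g := by
  refine op_mul_of_indicator hf (fun Δ hΔ => ?_) hg
  have h1 : F.op (fun x => Δ.indicator (fun _ => 1) x * f x) =
      F.op (Δ.indicator fun _ => 1) * F.op f := by
    refine op_mul_of_indicator (isBdd_indicator hΔ) (fun Δ' hΔ' => ?_) hf
    rw [op_indicator hΔ, ← hF Δ Δ' hΔ hΔ', ← op_indicator (hΔ.inter hΔ')]
    congr 1
    ext x
    by_cases h1 : x ∈ Δ <;> by_cases h2 : x ∈ Δ' <;> simp [h1, h2]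
  have h2 := congrArg star h1
  rw [star_mul, ((isBdd_indicator hΔ).mul hf).isSelfAdjoint_op.star_eq, hf.isSelfAdjoint_op.star_eq,
    (isBdd_indicator hΔ).isSelfAdjoint_op.star_eq, op_indicator hΔ] at h2
  rw [← h2]
  congr 1
  ext x
  rw [mul_comm]

/-- For disjoint `A`, `B` the sum `F A + F B = F (A ∪ B)` is idempotent, so `F A` and `F B`
anticommute; multiplying by `F A` on either side shows that they also commute, hence their product
is zero. The general case follows by splitting off `Δ ∩ Δ'`. -/
theorem apply_inter_of_isSpectral (hF : F.IsSpectral) {Δ Δ' : Set X} (hΔ : MeasurableSet Δ)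
    (hΔ' : MeasurableSet Δ') : F (Δ ∩ Δ') = F Δ * F Δ' := by
  have disj : ∀ A B : Set X, MeasurableSet A → MeasurableSet B → Disjoint A B →
      F A * F B = 0 := by
    intro A B hA hB hd
    have e1 : F A * F A = F A := (hF A hA).isIdempotentElem
    have e2 : F B * F B = F B := (hF B hB).isIdempotentElem
    have e3 : (F A + F B) * (F A + F B) = F A + F B := by
      rw [← apply_union hA hB hd]
      exact (hF _ (hA.union hB)).isIdempotentElem
    have e4 : F A * F B + F B * F A = 0 := by
      rw [add_mul, mul_add, mul_add, e1, e2] at e3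
      have : F A + F B + (F A * F B + F B * F A) = F A + F B + 0 := by
        rw [add_zero]
        refine Eq.trans ?_ e3
        abel
      exact add_left_cancel this
    have e5 : F A * F B + F A * F B * F A = 0 := by
      have := congrArg (F A * ·) e4
      simpa only [mul_add, mul_zero, ← mul_assoc, e1] using this
    have e6 : F A * F B * F A + F B * F A = 0 := by
      have := congrArg (· * F A) e4
      simpa only [add_mul, zero_mul, mul_assoc, e1] using this
    have e7 : F A * F B = F B * F A := by
      rw [eq_neg_of_add_eq_zero_left e5, eq_neg_of_add_eq_zero_right e6]
    rw [← e7] at e4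
    rw [← two_smul ℂ] at e4
    exact (smul_eq_zero.mp e4).resolve_left two_ne_zero
  have e1 : F Δ = F (Δ ∩ Δ') + F (Δ \ Δ') := by
    rw [← apply_union (hΔ.inter hΔ') (hΔ.diff hΔ') Set.disjoint_sdiff_inter.symm,
      Set.inter_union_sdiff]
  have e2 : F Δ' = F (Δ ∩ Δ') + F (Δ' \ Δ) := by
    rw [← apply_union (hΔ.inter hΔ') (hΔ'.diff hΔ), Set.inter_comm, Set.inter_union_sdiff]
    rw [Set.inter_comm]
    exact Set.disjoint_sdiff_inter.symm
  rw [e1, e2, add_mul, mul_add, mul_add, disj _ _ (hΔ.diff hΔ') (hΔ.inter hΔ')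
    Set.disjoint_sdiff_inter, disj _ _ (hΔ.inter hΔ') (hΔ'.diff hΔ) (by
      rw [Set.inter_comm]; exact Set.disjoint_sdiff_inter.symm),
    disj _ _ (hΔ.diff hΔ') (hΔ'.diff hΔ) (Set.disjoint_left.mpr fun x h1 h2 => h2.2 h1.1),
    add_zero, add_zero, add_zero]
  exact (hF _ (hΔ.inter hΔ')).isIdempotentElem.symm

/-- Complete positivity of the operator integral. -/
theorem re_sum_inner_op_nonneg {ι : Type*} [Fintype ι] {a : ι → X → ℝ}
    (ha : ∀ i, F.IsBdd (a i)) (v : ι → H) :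
    0 ≤ (∑ i, ∑ j, inner ℂ (v i) (F.op (fun x => a i x * a j x) (v j))).re := by
  have simple : ∀ s : SimpleFunc X (ι → ℝ), (∀ i, F.IsBdd fun x => s x i) ∧
      0 ≤ (∑ i, ∑ j, inner ℂ (v i) (F.op (fun x => s x i * s x j) (v j))).re := by
    intro s
    have hb : ∀ (s : SimpleFunc X (ι → ℝ)) i, F.IsBdd fun x => s x i := fun s i =>
      isBdd_simpleFunc (s.map fun y => y i)
    refine ⟨hb s, ?_⟩
    induction s using SimpleFunc.induction with
    | @const c Δ hΔ =>
      have e : ∀ i j, F.op (fun x => (SimpleFunc.piecewise Δ hΔ (SimpleFunc.const X c)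
          (SimpleFunc.const X 0)) x i * (SimpleFunc.piecewise Δ hΔ (SimpleFunc.const X c)
          (SimpleFunc.const X 0)) x j) = ((c i : ℂ) * c j) • F Δ := by
        intro i j
        rw [← op_indicator hΔ, ← Complex.ofReal_mul, ← (isBdd_indicator hΔ).op_const_mul]
        congr 1
        ext x
        by_cases hx : x ∈ Δ <;> simp [hx]
      -- For the step function `c` on `Δ` the double sum collapses to the form of `F Δ` at `∑ i, c i
      -- • v i`.
      have := (Complex.nonneg_iff.mp (F.nonneg' (∑ i, (c i : ℂ) • v i) Δ hΔ)).1
      simp only [map_sum, map_smul, sum_inner, inner_sum, inner_smul_left, inner_smul_right,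
        Complex.conj_ofReal] at this
      simp only [e, smul_apply, inner_smul_right]
      rw [Finset.sum_comm]
      simp only [Finset.mul_sum] at this
      exact this.trans_eq (congrArg Complex.re
        (Finset.sum_congr rfl fun _ _ => Finset.sum_congr rfl fun _ _ => by ring))
    | @add s t hd hs ht =>
      have e : ∀ i j, F.op (fun x => (s + t) x i * (s + t) x j) =
          F.op (fun x => s x i * s x j) + F.op (fun x => t x i * t x j) := by
        intro i j
        rw [← ((hb s i).mul (hb s j)).op_add ((hb t i).mul (hb t j))]
        congr 1
        ext x
        -- Disjoint supports kill the cross terms.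
        have : s x = 0 ∨ t x = 0 := by
          by_contra! hc
          exact Set.disjoint_left.mp hd hc.1 hc.2
        rcases this with h0 | h0 <;> simp [h0]
      simp only [e, add_apply, inner_add_right, Finset.sum_add_distrib, Complex.add_re]
      exact add_nonneg hs ht
  have hm : Measurable fun x i => a i x := measurable_pi_lambda _ fun i => (ha i).1
  choose M hM using fun i => (ha i).2
  -- The family is approximated as one vector-valued function, so that all products `a i * a j` come
  -- from the same simple function.
  set s : ℕ → SimpleFunc X (ι → ℝ) := fun n =>
    SimpleFunc.approxOn (fun x i => a i x) hm Set.univ 0 (Set.mem_univ _) n with hs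
  have hlim : ∀ x, Tendsto (fun n => s n x) atTop (𝓝 fun i => a i x) := fun x =>
    SimpleFunc.tendsto_approxOn hm (Set.mem_univ _) (by simp)
  have hbound : ∀ h, ∀ n, ∀ᵐ x ∂F.diag h, ‖s n x‖ ≤ (∑ i, |M i|) + ∑ i, |M i| := by
    intro h n
    filter_upwards [ae_all_iff.mpr fun i => hM i h] with x hx
    have : ‖fun i => a i x‖ ≤ ∑ i, |M i| := by
      refine (pi_norm_le_iff_of_nonneg (by positivity)).mpr fun i => ?_
      exact ((hx i).trans (le_abs_self _)).trans
        (Finset.single_le_sum (f := fun i => |M i|) (fun i _ => abs_nonneg _) (Finset.mem_univ i))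
    exact (SimpleFunc.norm_approxOn_zero_le hm (Set.mem_univ _) x n).trans (add_le_add this this)
  have key : Tendsto (fun n => (∑ i, ∑ j,
      inner ℂ (v i) (F.op (fun x => s n x i * s n x j) (v j))).re) atTop
      (𝓝 (∑ i, ∑ j, inner ℂ (v i) (F.op (fun x => a i x * a j x) (v j))).re) := by
    refine (Complex.continuous_re.tendsto _).comp ?_
    refine tendsto_finsetSum _ fun i _ => tendsto_finsetSum _ fun j _ => ?_
    refine tendsto_inner_op
      (M := ((∑ i, |M i|) + ∑ i, |M i|) * ((∑ i, |M i|) + ∑ i, |M i|))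
      (fun n => ((simple (s n)).1 i).mul ((simple (s n)).1 j)) ((ha i).mul (ha j))
      (fun h n => ?_) (fun h => ae_of_all _ fun x => ?_) _ _
    · filter_upwards [hbound h n] with x hx
      rw [abs_mul]
      exact mul_le_mul ((norm_le_pi_norm _ i).trans hx) ((norm_le_pi_norm _ j).trans hx)
        (abs_nonneg _) (by positivity)
    · have := tendsto_pi_nhds.mp (hlim x)
      exact (this i).mul (this j)
  exact ge_of_tendsto' key fun n => (simple (s n)).2

end SemispectralMeasure

/-! ### From powers to continuous functions to Borel sets. -/

namespace SemispectralMeasure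

section Generic

variable {X : Type*} [MeasurableSpace X] {H : Type*} [NormedAddCommGroup H]
  [InnerProductSpace ℂ H] {F : SemispectralMeasure X H} {f g : X → ℝ} [CompleteSpace H]

theorem op_mul_pow {S : H →L[ℂ] H} (hg : F.IsBdd g)
    (hS : ∀ f, F.IsBdd f → F.op (fun x => f x * g x) = F.op f * S) (hf : F.IsBdd f) (n : ℕ) :
    F.op (fun x => f x * g x ^ n) = F.op f * S ^ n := by
  induction n with
  | zero => simp
  | succ n ih =>
    have := hS _ (hf.mul (hg.pow n))
    rw [ih] at this
    simp only [pow_succ, ← mul_assoc]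
    exact this

open Polynomial in
theorem op_mul_polynomial {S : H →L[ℂ] H} (hg : F.IsBdd g) (hf : F.IsBdd f)
    (hS : ∀ n : ℕ, F.op (fun x => f x * g x ^ n) = F.op f * S ^ n) (p : ℝ[X]) :
    F.IsBdd (fun x => p.eval (g x)) ∧
      F.op (fun x => f x * p.eval (g x)) = F.op f * aeval S p := by
  induction p using Polynomial.induction_on' with
  | add p q hp hq =>
    simp only [eval_add, mul_add, map_add]
    exact ⟨hp.1.add hq.1, by rw [(hf.mul hp.1).op_add (hf.mul hq.1), hp.2, hq.2]⟩
  | monomial n c =>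
    simp only [eval_monomial, aeval_monomial]
    refine ⟨(hg.pow n).const_mul c, ?_⟩
    have e : (fun x => f x * (c * g x ^ n)) = fun x => c * (f x * g x ^ n) := by ext x; ring
    rw [e, (hf.mul (hg.pow n)).op_const_mul, hS n, ← Algebra.smul_def, mul_smul_comm,
      Complex.coe_smul]

/-- If the operator integral is multiplicative against `f` for bounded continuous functions, it is
multiplicative against `f` for indicators of Borel sets. -/
theorem op_mul_indicator_of_continuous [TopologicalSpace X] [HasOuterApproxClosed X]
    [BorelSpace X] (hf : F.IsBdd f)
    (hc : ∀ g : X → ℝ, Continuous g → F.IsBdd g →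
      F.op (fun x => f x * g x) = F.op f * F.op g) {Δ : Set X} (hΔ : MeasurableSet Δ) :
    F.op (fun x => f x * Δ.indicator (fun _ => 1) x) = F.op f * F Δ := by
  refine MeasurableSpace.induction_on_inter
    (C := fun Δ _ => F.op (fun x => f x * Δ.indicator (fun _ => 1) x) = F.op f * F Δ)
    (BorelSpace.measurable_eq.trans borel_eq_generateFrom_isClosed) isPiSystem_isClosed
    ?_ (fun Δ hΔ => ?_) (fun Δ hΔ ih => ?_) (fun Δ hd hΔ ih => ?_) Δ hΔ
  · have := hc (fun _ => 0) continuous_const (isBdd_const 0)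
    rw [← op_indicator MeasurableSet.empty]
    simpa using this
  -- The indicator of a closed set is a pointwise limit of continuous functions bounded by `1`.
  · replace hΔ : IsClosed Δ := hΔ
    rw [← op_indicator hΔ.measurableSet]
    have hb : ∀ n, F.IsBdd fun x => (hΔ.apprSeq n x : ℝ) := fun n =>
      isBdd_of_forall_le (M := 1) (by fun_prop) fun x => by
        rw [abs_of_nonneg (NNReal.coe_nonneg _)]
        exact_mod_cast HasOuterApproxClosed.apprSeq_apply_le_one hΔ n x
    refine op_mul_of_tendsto (M := 1) hf hb (isBdd_indicator hΔ.measurableSet)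
      (fun h n => ae_of_all _ fun x => ?_) (fun h => ae_of_all _ fun x => ?_)
      (fun n => hc _ (by fun_prop) (hb n))
    · rw [abs_of_nonneg (NNReal.coe_nonneg _)]
      exact_mod_cast HasOuterApproxClosed.apprSeq_apply_le_one hΔ n x
    · have := (NNReal.continuous_coe.tendsto _).comp (tendsto_pi_nhds.mp (HasOuterApproxClosed.tendsto_apprSeq hΔ) x)
      have e : Δ.indicator (fun _ => (1 : ℝ)) x =
          ((Δ.indicator (fun _ => (1 : ℝ≥0)) x : ℝ≥0) : ℝ) := by
        by_cases hx : x ∈ Δ <;> simp [hx]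
      rw [e]
      exact this
  · have e1 : F Δᶜ = 1 - F Δ := by
      rw [eq_sub_iff_add_eq, ← apply_union hΔ.compl hΔ disjoint_compl_left,
        Set.compl_union_self, F.univ']
    have e2 : (fun x => f x * Δᶜ.indicator (fun _ => 1) x) =
        fun x => f x + (-1) * (f x * Δ.indicator (fun _ => 1) x) := by
      ext x
      by_cases hx : x ∈ Δ <;> simp [hx]
    have hb := hf.mul (isBdd_indicator hΔ)
    rw [e2, hf.op_add (hb.const_mul _), hb.op_const_mul, ih, e1, mul_sub, mul_one]
    simp [sub_eq_add_neg]
  -- A countable disjoint union is the limit of its finite subunions, which are handled by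
  -- additivity.
  · have hfin : ∀ n, MeasurableSet (⋃ i ∈ Finset.range n, Δ i) := fun n =>
      Finset.measurableSet_biUnion _ fun i _ => hΔ i
    rw [← op_indicator (MeasurableSet.iUnion hΔ)]
    refine op_mul_of_tendsto (M := 1)
      (g' := fun n => (⋃ i ∈ Finset.range n, Δ i).indicator fun _ => 1) hf
      (fun n => isBdd_indicator (hfin n)) (isBdd_indicator (MeasurableSet.iUnion hΔ))
      (fun h n => ae_of_all _ fun x => ?_) (fun h => ae_of_all _ fun x => ?_) (fun n => ?_)
    · by_cases hx : x ∈ ⋃ i ∈ Finset.range n, Δ i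
      · rw [Set.indicator_of_mem hx, abs_one]
      · rw [Set.indicator_of_notMem hx, abs_zero]
        exact zero_le_one
    · exact ((tendsto_indicator_biUnion_finset Δ (fun _ => (1 : ℝ)) x).comp
        tendsto_finset_range).mono_right (pure_le_nhds _)
    · rw [op_indicator (hfin n)]
      induction n with
      | zero =>
        have := hc (fun _ => 0) continuous_const (isBdd_const 0)
        rw [← op_indicator (hfin 0)]
        simpa using this
      | succ n ihn =>
        have hdisj : Disjoint (⋃ i ∈ Finset.range n, Δ i) (Δ n) := by
          rw [Set.disjoint_iUnion₂_left]
          exact fun i hi => hd (Finset.mem_range.mp hi).ne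
        have e : ⋃ i ∈ Finset.range (n + 1), Δ i = (⋃ i ∈ Finset.range n, Δ i) ∪ Δ n := by
          rw [Finset.range_add_one, Finset.set_biUnion_insert, Set.union_comm]
        rw [e, apply_union (hfin n) (hΔ n) hdisj, mul_add, ← ihn, ← ih n,
          ← (hf.mul (isBdd_indicator (hfin n))).op_add (hf.mul (isBdd_indicator (hΔ n)))]
        congr 1
        ext x
        rw [← mul_add, Set.indicator_union_of_disjoint hdisj]

end Generic

variable {H : Type*} [NormedAddCommGroup H] [InnerProductSpace ℂ H]
  {F : SemispectralMeasure ℝ≥0 H}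

/-- `F` is concentrated on a bounded interval. -/
def IsBddSupport (F : SemispectralMeasure ℝ≥0 H) : Prop :=
  ∃ M : ℝ, ∀ h, ∀ᵐ x : ℝ≥0 ∂F.diag h, (x : ℝ) ≤ M

theorem HasCompactSupport.isBddSupport (hF : F.HasCompactSupport) : F.IsBddSupport := by
  obtain ⟨K, hK, h0⟩ := hF
  obtain ⟨M, hM⟩ := hK.bddAbove
  refine ⟨M, fun h => ?_⟩
  have : F.diag h Kᶜ = 0 := by
    rw [F.diag_apply h hK.isClosed.measurableSet.compl, h0]
    simp
  filter_upwards [compl_mem_ae_iff.mpr this] with x hx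
  rw [compl_compl] at hx
  exact_mod_cast hM hx

theorem IsBddSupport.isBdd (hF : F.IsBddSupport) {g : ℝ≥0 → ℝ} (hg : Continuous g) :
    F.IsBdd g := by
  obtain ⟨M, hM⟩ := hF
  obtain ⟨C, hC⟩ := (isCompact_Icc (a := (0 : ℝ≥0)) (b := M.toNNReal)).exists_bound_of_continuousOn
    hg.continuousOn
  refine ⟨hg.measurable, C, fun h => ?_⟩
  filter_upwards [hM h] with x hx
  exact hC x ⟨zero_le, NNReal.le_toNNReal_of_coe_le hx⟩

variable [CompleteSpace H]

/-- Passage from powers to continuous functions. -/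
theorem op_mul_cfc (hF : F.IsBddSupport) {f : ℝ≥0 → ℝ} (hf : F.IsBdd f) {B : H →L[ℂ] H}
    (hB : 0 ≤ B) (hpow : ∀ n : ℕ, F.op (fun x => f x * (x : ℝ) ^ n) = F.op f * B ^ n)
    {g : ℝ → ℝ} (hg : Continuous g) : F.op (fun x => f x * g x) = F.op f * cfc g B := by
  obtain ⟨M, hM⟩ := id hF
  -- `[0, R]` carries `F` and contains the spectrum of `B`, so the same polynomials approximate `g`
  -- on both sides.
  set R := max M (‖B‖ * ‖(1 : H →L[ℂ] H)‖) with hR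
  choose p hp using fun n : ℕ => exists_polynomial_near_of_continuousOn 0 R g hg.continuousOn
    (1 / ((n : ℝ) + 1)) (by positivity)
  have hcoe : F.IsBdd fun x => (x : ℝ) := hF.isBdd NNReal.continuous_coe
  have hP := fun n => op_mul_polynomial hcoe hf hpow (p n)
  have hgb : F.IsBdd fun x => g x := hF.isBdd (hg.comp NNReal.continuous_coe)
  obtain ⟨N, hN⟩ := hf.2
  obtain ⟨C, hC⟩ := hgb.2
  have hdist : ∀ h, ∀ᵐ x : ℝ≥0 ∂F.diag h, ∀ n, |(p n).eval (x : ℝ) - g x| < 1 / ((n : ℝ) + 1) := by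
    intro h
    filter_upwards [hM h] with x hx n
    exact hp n x ⟨x.2, hx.trans (le_max_left _ _)⟩
  have hspec : ∀ x ∈ spectrum ℝ B, x ∈ Set.Icc 0 R := fun x hx =>
    ⟨spectrum_nonneg_of_nonneg hB hx, (le_abs_self x).trans
      ((spectrum.norm_le_norm_mul_of_mem hx).trans (le_max_right _ _))⟩
  have hcfc : Tendsto (fun n => cfc (p n).eval B) atTop (𝓝 (cfc g B)) := by
    rw [tendsto_iff_norm_sub_tendsto_zero]
    refine squeeze_zero (fun n => norm_nonneg _) (fun n => ?_)
      tendsto_one_div_add_atTop_nhds_zero_nat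
    rw [← cfc_sub (p n).eval g B (by fun_prop) (by fun_prop)]
    exact norm_cfc_le (by positivity) fun x hx => (hp n x (hspec x hx)).le
  ext k
  refine ext_inner_left ℂ fun h => ?_
  have h1 : Tendsto (fun n => inner ℂ h (F.op (fun x => f x * (p n).eval (x : ℝ)) k)) atTop
      (𝓝 (inner ℂ h (F.op (fun x => f x * g x) k))) := by
    -- The approximation error is at most `1`, so the polynomials are bounded by `C + 1`.
    refine tendsto_inner_op (M := N * (C + 1)) (fun n => hf.mul (hP n).1) (hf.mul hgb)
      (fun h n => ?_) (fun h => ?_) h k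
    · filter_upwards [hdist h, hN h, hC h] with x h1 h2 h3
      rw [abs_mul]
      have h4 : |(p n).eval (x : ℝ)| ≤ C + 1 := by
        have h5 : 1 / ((n : ℝ) + 1) ≤ 1 := by
          rw [div_le_one (by positivity)]
          linarith [(Nat.cast_nonneg n : (0 : ℝ) ≤ n)]
        have h6 := abs_sub_abs_le_abs_sub ((p n).eval (x : ℝ)) (g x)
        linarith [h1 n]
      exact mul_le_mul h2 h4 (abs_nonneg _) ((abs_nonneg _).trans h2)
    · filter_upwards [hdist h] with x hx
      refine Tendsto.const_mul _ ?_
      rw [tendsto_iff_norm_sub_tendsto_zero]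
      exact squeeze_zero (fun n => norm_nonneg _) (fun n => (hx n).le)
        tendsto_one_div_add_atTop_nhds_zero_nat
  have h2 : Tendsto (fun n => inner ℂ h ((F.op f * cfc (p n).eval B) k)) atTop
      (𝓝 (inner ℂ h ((F.op f * cfc g B) k))) := by
    have : Continuous fun S : H →L[ℂ] H => inner ℂ h ((F.op f * S) k) := by fun_prop
    exact (this.tendsto _).comp hcfc
  have e : ∀ n, F.op (fun x => f x * (p n).eval (x : ℝ)) = F.op f * cfc (p n).eval B := fun n => by
    rw [(hP n).2, cfc_polynomial (p n) B]
  simp_rw [e] at h1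
  exact tendsto_nhds_unique h1 h2

theorem op_cfc (hF : F.IsBddSupport) {B : H →L[ℂ] H} (hB : 0 ≤ B)
    (hpow : ∀ n : ℕ, F.op (fun x => (x : ℝ) ^ n) = B ^ n) {g : ℝ → ℝ} (hg : Continuous g) :
    F.op (fun x => g x) = cfc g B := by
  simpa [op_one] using op_mul_cfc hF (f := fun _ => 1) (isBdd_const 1) hB
    (by simpa [op_one] using hpow) hg

theorem op_rpow (hF : F.IsBddSupport) {B : H →L[ℂ] H} (hB : 0 ≤ B)
    (hpow : ∀ n : ℕ, F.op (fun x => (x : ℝ) ^ n) = B ^ n) {p : ℝ} (hp : 0 ≤ p) :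
    F.op (fun x => (x : ℝ) ^ p) = B ^ p := by
  rw [op_cfc hF hB hpow (Real.continuous_rpow_const hp), CFC.rpow_eq_cfc_real hB]

theorem IsSpectral.op_pow (hS : F.IsSpectral) (hF : F.IsBddSupport) (n : ℕ) :
    F.op (fun x => (x : ℝ) ^ n) = F.op (fun x => (x : ℝ)) ^ n := by
  have hcoe : F.IsBdd fun x => (x : ℝ) := hF.isBdd NNReal.continuous_coe
  simpa [op_one] using op_mul_pow hcoe (fun f hf => op_mul_of_inter
    (fun Δ Δ' hΔ hΔ' => apply_inter_of_isSpectral hS hΔ hΔ') hf hcoe) (isBdd_const 1) n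

/-- With `f` the indicator of `Δ`, multiplicativity against `f` passes from powers to continuous
functions, then to indicators; testing on `Δ` itself gives idempotency. -/
theorem isSpectral_of_op_mul (hF : F.IsBddSupport) {B : H →L[ℂ] H} (hB : 0 ≤ B)
    (hmul : ∀ f, F.IsBdd f → F.op (fun x => f x * (x : ℝ)) = F.op f * B) : F.IsSpectral := by
  have hcoe : F.IsBdd fun x => (x : ℝ) := hF.isBdd NNReal.continuous_coe
  have hpow : ∀ n : ℕ, F.op (fun x => (x : ℝ) ^ n) = B ^ n := by
    simpa [op_one] using op_mul_pow hcoe hmul (isBdd_const 1)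
  intro Δ hΔ
  have hind : F.IsBdd (Δ.indicator fun _ => 1) := isBdd_indicator hΔ
  have key := op_mul_indicator_of_continuous hind (fun g hg hgb => by
    -- `g` is extended to `ℝ` so that the real functional calculus of `B` applies.
    have hg' : Continuous fun r : ℝ => g r.toNNReal := hg.comp continuous_real_toNNReal
    have e1 := op_mul_cfc hF hind hB (op_mul_pow hcoe hmul hind) hg'
    have e2 := op_cfc hF hB hpow hg'
    simp only [Real.toNNReal_coe] at e1 e2
    rw [e1, e2]) hΔ
  rw [op_indicator hΔ] at key
  constructor
  · rw [IsIdempotentElem, ← key, ← op_indicator hΔ]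
    congr 1
    ext x
    by_cases hx : x ∈ Δ <;> simp [hx]
  · rw [← op_indicator hΔ]
    exact hind.isSelfAdjoint_op

end SemispectralMeasure

/-! ### The operator Jensen inequality for the inverse and its equality case. -/

namespace SemispectralMeasure

section Inverse

variable {X : Type*} [MeasurableSpace X] {H : Type*} [NormedAddCommGroup H]
  [InnerProductSpace ℂ H] {F : SemispectralMeasure X H} {f w : X → ℝ} [CompleteSpace H]

/-- Positivity of the Gram matrix behind the operator Jensen inequality for `w ↦ w⁻¹`. -/
theorem re_inner_op_inv_nonneg (hw : F.IsBdd w) (hw' : F.IsBdd fun x => (w x)⁻¹)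
    (hpos : ∀ x, 0 < w x) (hf : F.IsBdd f) {R : H →L[ℂ] H} (hR : F.op w * R = 1) (k l : H) :
    0 ≤ (inner ℂ k (F.op (fun x => (w x)⁻¹) k)).re - (inner ℂ k (R k)).re
      + 2 * (inner ℂ l ((F.op (fun x => f x * (w x)⁻¹) - F.op f * R) k)).re
      + (inner ℂ l (F.op (fun x => f x * f x * (w x)⁻¹) l)).re := by
  have hsq : ∀ {g : X → ℝ}, F.IsBdd g → F.IsBdd fun x => √(g x) := by
    rintro g ⟨hg, M, hM⟩
    refine ⟨hg.sqrt, √M, fun h => ?_⟩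
    filter_upwards [hM h] with x hx
    rw [abs_of_nonneg (Real.sqrt_nonneg _)]
    exact Real.sqrt_le_sqrt ((le_abs_self _).trans hx)
  have hr := hsq hw
  have hr' := hsq hw'
  have h1 : ∀ x, √(w x) * √(w x) = w x := fun x => Real.mul_self_sqrt (hpos x).le
  have h2 : ∀ x, √((w x)⁻¹) * √((w x)⁻¹) = (w x)⁻¹ := fun x =>
    Real.mul_self_sqrt (inv_nonneg.mpr (hpos x).le)
  have h3 : ∀ x, √((w x)⁻¹) * √(w x) = 1 := fun x => by
    rw [← Real.sqrt_mul (inv_nonneg.mpr (hpos x).le), inv_mul_cancel₀ (hpos x).ne', Real.sqrt_one]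
  -- The products of `w^(-1/2)`, `w^(1/2)`, `f w^(-1/2)` are `w⁻¹`, `1`, `w`, `f w⁻¹`, `f`, `f²
  -- w⁻¹`. The vector `-(R k)` completes the square: since `F.op w * R = 1`, its terms with `k` sum
  -- to `-⟨R k, k⟩`.
  have key := re_sum_inner_op_nonneg (F := F)
    (a := ![fun x => √((w x)⁻¹), fun x => √(w x), fun x => f x * √((w x)⁻¹)])
    (by intro i; fin_cases i; exacts [hr', hr, hf.mul hr']) ![k, -(R k), l]
  have e20 : ∀ x, f x * √((w x)⁻¹) * √((w x)⁻¹) = f x * (w x)⁻¹ := fun x => by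
    rw [mul_assoc, h2]
  have e02 : ∀ x, √((w x)⁻¹) * (f x * √((w x)⁻¹)) = f x * (w x)⁻¹ := fun x => by
    rw [mul_comm, e20]
  have e21 : ∀ x, f x * √((w x)⁻¹) * √(w x) = f x := fun x => by
    rw [mul_assoc, h3, mul_one]
  have e12 : ∀ x, √(w x) * (f x * √((w x)⁻¹)) = f x := fun x => by
    rw [mul_comm, e21]
  have e22 : ∀ x, f x * √((w x)⁻¹) * (f x * √((w x)⁻¹)) = f x * f x * (w x)⁻¹ := fun x => by
    rw [mul_mul_mul_comm, h2]
  have e10 : ∀ x, √(w x) * √((w x)⁻¹) = 1 := fun x => by rw [mul_comm, h3]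
  have hRk : F.op w (R k) = k := by rw [← mul_apply_eq_comp, hR, one_apply_eq_self]
  have s1 : (inner ℂ k (F.op (fun x => f x * (w x)⁻¹) l)).re =
      (inner ℂ l (F.op (fun x => f x * (w x)⁻¹) k)).re := by
    rw [← (hf.mul hw').inner_op_left, ← inner_conj_symm, Complex.conj_re]
  have s2 : (inner ℂ (R k) (F.op f l)).re = (inner ℂ l (F.op f (R k))).re := by
    rw [← hf.inner_op_left, ← inner_conj_symm, Complex.conj_re]
  simp [Fin.sum_univ_three, h1, h2, h3, e20, e02, e21, e12, e22, e10, op_one, hRk, s1, s2,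
    -Real.sqrt_inv] at key
  simp only [sub_apply, mul_apply_eq_comp, inner_sub_right, Complex.sub_re]
  linarith

/-- The equality case of the operator Jensen inequality for `w ↦ w⁻¹`. -/
theorem op_mul_inv_of_op_inv_eq (hw : F.IsBdd w) (hw' : F.IsBdd fun x => (w x)⁻¹)
    (hpos : ∀ x, 0 < w x) (hf : F.IsBdd f) (hR : F.op w * F.op (fun x => (w x)⁻¹) = 1) :
    F.op (fun x => f x * (w x)⁻¹) = F.op f * F.op (fun x => (w x)⁻¹) := by
  rw [← sub_eq_zero]
  ext k
  set d := (F.op (fun x => f x * (w x)⁻¹) - F.op f * F.op (fun x => (w x)⁻¹)) k with hd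
  rw [zero_apply]
  by_contra hne
  have hpos' : 0 < ‖d‖ ^ 2 := by positivity
  set c := (inner ℂ d (F.op (fun x => f x * f x * (w x)⁻¹) d)).re with hc
  -- With `l = -ε d` the constant term vanishes and what remains is `-2ε‖d‖² + ε²c`. This `ε` makes
  -- `ε c ≤ ‖d‖²`, so the expression is negative.
  set ε := ‖d‖ ^ 2 / (|c| + 1) with hε
  have hε0 : 0 < ε := by positivity
  have key := re_inner_op_inv_nonneg hw hw' hpos hf hR k (-((ε : ℂ) • d))
  rw [← hd] at key
  have e1 : (inner ℂ d d).re = ‖d‖ ^ 2 := by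
    rw [inner_self_eq_norm_sq_to_K]
    norm_cast
  simp only [sub_self, inner_neg_left, inner_smul_left, Complex.conj_ofReal, map_neg, map_smul,
    inner_neg_right, inner_smul_right, Complex.neg_re, Complex.re_ofReal_mul, e1,
    ← hc] at key
  have e2 : ε * (|c| + 1) = ‖d‖ ^ 2 := by
    rw [hε]
    field_simp
  have e3 : ε * c ≤ ε * |c| := mul_le_mul_of_nonneg_left (le_abs_self c) hε0.le
  nlinarith

end Inverse

/-! ### Resolvents and the integral representation of fractional powers. -/

open Real (rpowIntegrand₀₁)

variable {H : Type*} [NormedAddCommGroup H] [InnerProductSpace ℂ H]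
  {F : SemispectralMeasure ℝ≥0 H} [CompleteSpace H]

/-- `cfc (fun x => (t + x)⁻¹) B` is the resolvent `(t + B)⁻¹`. -/
theorem smul_add_mul_cfc_inv {B : H →L[ℂ] H} (hB : 0 ≤ B) {t : ℝ} (ht : 0 < t) :
    ((t : ℂ) • 1 + B) * cfc (fun x : ℝ => (t + x)⁻¹) B = 1 := by
  have hpos : ∀ x ∈ spectrum ℝ B, 0 < t + x := fun x hx =>
    add_pos_of_pos_of_nonneg ht (spectrum_nonneg_of_nonneg hB hx)
  have hc : ContinuousOn (fun x : ℝ => (t + x)⁻¹) (spectrum ℝ B) :=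
    ContinuousOn.inv₀ (by fun_prop) fun x hx => (hpos x hx).ne'
  have e : ((t : ℂ) • 1 + B) = cfc (fun x : ℝ => t + x) B := by
    rw [cfc_const_add .., cfc_id' ℝ B, Algebra.algebraMap_eq_smul_one, Complex.coe_smul]
  rw [e, ← cfc_mul (fun x : ℝ => t + x) _ B (by fun_prop) hc, ← cfc_const_one ℝ B]
  exact cfc_congr fun x hx => mul_inv_cancel₀ (hpos x hx).ne'

theorem continuous_inv_add {t : ℝ} (ht : 0 < t) : Continuous fun x : ℝ≥0 => (t + (x : ℝ))⁻¹ :=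
  Continuous.inv₀ (by fun_prop) fun x => (add_pos_of_pos_of_nonneg ht x.2).ne'

theorem op_add_coe (hF : F.IsBddSupport) (t : ℝ) :
    F.op (fun x : ℝ≥0 => t + (x : ℝ)) = (t : ℂ) • 1 + F.op (fun x => (x : ℝ)) := by
  rw [(isBdd_const t).op_add (hF.isBdd NNReal.continuous_coe), op_const]

/-- Equality in Jensen's inequality at one point of the resolvent set forces multiplicativity. -/
theorem op_mul_coe_of_op_inv_eq (hF : F.IsBddSupport) {B : H →L[ℂ] H} (hB : 0 ≤ B)
    (h1 : F.op (fun x => (x : ℝ)) = B) {t : ℝ} (ht : 0 < t)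
    (heq : F.op (fun x : ℝ≥0 => (t + (x : ℝ))⁻¹) = cfc (fun x : ℝ => (t + x)⁻¹) B)
    {f : ℝ≥0 → ℝ} (hf : F.IsBdd f) : F.op (fun x => f x * (x : ℝ)) = F.op f * B := by
  have hcoe : F.IsBdd fun x => (x : ℝ) := hF.isBdd NNReal.continuous_coe
  have hw : F.IsBdd fun x : ℝ≥0 => t + (x : ℝ) := (isBdd_const t).add hcoe
  have hw' : F.IsBdd fun x : ℝ≥0 => (t + (x : ℝ))⁻¹ := hF.isBdd (continuous_inv_add ht)
  have hpos : ∀ x : ℝ≥0, 0 < t + (x : ℝ) := fun x => add_pos_of_pos_of_nonneg ht x.2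
  have hR := smul_add_mul_cfc_inv hB ht
  have hC : F.op (fun x : ℝ≥0 => t + (x : ℝ)) = (t : ℂ) • 1 + B := by rw [op_add_coe hF, h1]
  -- Using `f * w` in place of `f` cancels the inverse and yields `F.op f = F.op (f * w) * (t +
  -- B)⁻¹`.
  have key := op_mul_inv_of_op_inv_eq hw hw' hpos (hf.mul hw) (by rw [hC, heq, hR])
  have e : (fun x : ℝ≥0 => f x * (t + (x : ℝ)) * (t + (x : ℝ))⁻¹) = f := by
    ext x
    rw [mul_assoc, mul_inv_cancel₀ (hpos x).ne', mul_one]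
  have hR' : cfc (fun x : ℝ => (t + x)⁻¹) B * ((t : ℂ) • 1 + B) = 1 := by
    rw [← heq, ← hC]
    have := congrArg star hR
    rw [← heq, ← hC, star_mul, star_one, hw'.isSelfAdjoint_op.star_eq,
      hw.isSelfAdjoint_op.star_eq] at this
    exact this
  rw [e, heq] at key
  have e2 : F.op (fun x : ℝ≥0 => f x * (t + (x : ℝ))) =
      (t : ℂ) • F.op f + F.op (fun x => f x * (x : ℝ)) := by
    rw [← hf.op_const_mul, ← (hf.const_mul t).op_add (hf.mul hcoe)]
    congr 1
    ext x
    ring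
  have e3 : F.op f * ((t : ℂ) • 1 + B) = F.op (fun x : ℝ≥0 => f x * (t + (x : ℝ))) := by
    rw [key, mul_assoc, hR', mul_one]
  rw [e2, mul_add, mul_smul_comm, mul_one] at e3
  exact (add_left_cancel e3).symm

/-- The operator Jensen inequality for the resolvent function. -/
theorem re_inner_cfc_inv_le (hF : F.IsBddSupport) {B : H →L[ℂ] H} (hB : 0 ≤ B)
    (h1 : F.op (fun x => (x : ℝ)) = B) {t : ℝ} (ht : 0 < t) (h : H) :
    (inner ℂ h (cfc (fun x : ℝ => (t + x)⁻¹) B h)).re ≤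
      ∫ x : ℝ≥0, (t + (x : ℝ))⁻¹ ∂F.diag h := by
  have hcoe : F.IsBdd fun x => (x : ℝ) := hF.isBdd NNReal.continuous_coe
  have hw' : F.IsBdd fun x : ℝ≥0 => (t + (x : ℝ))⁻¹ := hF.isBdd (continuous_inv_add ht)
  -- With `l = 0` the terms containing `f` vanish, so the choice of `f` is immaterial.
  have key := re_inner_op_inv_nonneg ((isBdd_const t).add hcoe) hw'
    (fun x : ℝ≥0 => add_pos_of_pos_of_nonneg ht x.2) hcoe
    (R := cfc (fun x : ℝ => (t + x)⁻¹) B)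
    (by rw [op_add_coe hF, h1, smul_add_mul_cfc_inv hB ht]) h 0
  rw [hw'.inner_op] at key
  simpa using key

/-- The resolvent enters with a negative sign, so Jensen for resolvents becomes the opposite
inequality for these integrands. -/
theorem re_inner_cfc_rpowIntegrand₀₁ {B : H →L[ℂ] H} (hB : 0 ≤ B) {s t : ℝ}
    (hs : s ∈ Set.Ioo 0 1) (ht : 0 < t) (h : H) :
    (inner ℂ h (cfc (rpowIntegrand₀₁ s t) B h)).re =
      t ^ (s - 1) * ‖h‖ ^ 2 - t ^ s * (inner ℂ h (cfc (fun x : ℝ => (t + x)⁻¹) B h)).re := by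
  have hpos : ∀ x ∈ spectrum ℝ B, 0 < t + x := fun x hx =>
    add_pos_of_pos_of_nonneg ht (spectrum_nonneg_of_nonneg hB hx)
  have hc : ContinuousOn (fun x : ℝ => (t + x)⁻¹) (spectrum ℝ B) :=
    ContinuousOn.inv₀ (by fun_prop) fun x hx => (hpos x hx).ne'
  have e1 : (inner ℂ h h).re = ‖h‖ ^ 2 := by
    rw [inner_self_eq_norm_sq_to_K]
    norm_cast
  rw [Real.rpowIntegrand₀₁_eq_sub hs.2.ne ht, cfc_sub (fun _ : ℝ => t ^ (s - 1)) _ B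
    (by fun_prop) (hc.const_mul _), cfc_const .., cfc_const_mul _ _ B hc, sub_apply,
    inner_sub_right, Complex.sub_re, Algebra.algebraMap_eq_smul_one, smul_apply, smul_apply,
    ← Complex.coe_smul, ← Complex.coe_smul, inner_smul_right, inner_smul_right,
    Complex.re_ofReal_mul, Complex.re_ofReal_mul, one_apply_eq_self, e1]

/-- The integral of `rpowIntegrand₀₁ s t` against a diagonal measure. -/
theorem integral_rpowIntegrand₀₁_diag {H : Type*} [NormedAddCommGroup H]
    [InnerProductSpace ℂ H] {F : SemispectralMeasure ℝ≥0 H} (hF : F.IsBddSupport) {s t : ℝ}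
    (hs : s ∈ Set.Ioo 0 1) (ht : 0 < t) (h : H) :
    Integrable (fun x : ℝ≥0 => rpowIntegrand₀₁ s t x) (F.diag h) ∧
    ∫ x : ℝ≥0, rpowIntegrand₀₁ s t x ∂F.diag h =
      t ^ (s - 1) * ‖h‖ ^ 2 - t ^ s * ∫ x : ℝ≥0, (t + (x : ℝ))⁻¹ ∂F.diag h := by
  have hw' : F.IsBdd fun x : ℝ≥0 => (t + (x : ℝ))⁻¹ := hF.isBdd (continuous_inv_add ht)
  rw [Real.rpowIntegrand₀₁_eq_sub hs.2.ne ht]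
  have i1 := (hw'.integrable h).const_mul (t ^ s)
  refine ⟨(integrable_const _).sub i1, ?_⟩
  rw [integral_sub (integrable_const _) i1, integral_const_mul, integral_const, Measure.real,
    diag_univ, ENNReal.toReal_ofReal (by positivity), smul_eq_mul, mul_comm]

/-- The integral representation of `B ^ s`, for `0 < s < 1`, with respect to Lebesgue measure. -/
theorem integral_cfc_rpowIntegrand₀₁ {B : H →L[ℂ] H} (hB : 0 ≤ B) {s : ℝ}
    (hs : s ∈ Set.Ioo 0 1) :
    IntegrableOn (fun t => cfc (rpowIntegrand₀₁ s t) B) (Set.Ioi 0) ∧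
    ∫ t in Set.Ioi 0, cfc (rpowIntegrand₀₁ s t) B =
      (∫ t in Set.Ioi 0, rpowIntegrand₀₁ s t 1) • B ^ s := by
  have hspec : ∀ x ∈ spectrum ℝ B, 0 ≤ x := fun x hx => spectrum_nonneg_of_nonneg hB hx
  set R := ‖B‖ * ‖(1 : H →L[ℂ] H)‖ with hR
  have hR0 : 0 ≤ R := by positivity
  have hle : ∀ x ∈ spectrum ℝ B, x ≤ R := fun x hx =>
    (le_abs_self x).trans (spectrum.norm_le_norm_mul_of_mem hx)
  have hf : ContinuousOn (Function.uncurry (rpowIntegrand₀₁ s)) (Set.Ioi 0 ×ˢ spectrum ℝ B) :=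
    Real.continuousOn_rpowIntegrand₀₁_uncurry hs _ hspec
  have hbound : ∀ᵐ t ∂(volume.restrict (Set.Ioi (0 : ℝ))), ∀ z ∈ spectrum ℝ B,
      ‖rpowIntegrand₀₁ s t z‖ ≤ rpowIntegrand₀₁ s t R := by
    filter_upwards [ae_restrict_mem measurableSet_Ioi] with t ht z hz
    rw [Real.norm_of_nonneg (Real.rpowIntegrand₀₁_nonneg hs.1 (le_of_lt ht) (hspec z hz))]
    exact Real.rpowIntegrand₀₁_monotoneOn hs (le_of_lt ht) (hspec z hz) hR0 (hle z hz)
  have hfin := (Real.integrableOn_rpowIntegrand₀₁_Ioi hs hR0).2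
  refine ⟨integrableOn_cfc measurableSet_Ioi _ _ B hf hbound hfin, ?_⟩
  rw [← cfc_setIntegral measurableSet_Ioi _ _ B hf hbound hfin, CFC.rpow_eq_cfc_real hB,
    ← cfc_smul _ _ B (Real.continuous_rpow_const hs.1.le).continuousOn]
  refine cfc_congr fun x hx => ?_
  simp only [smul_eq_mul]
  rw [Real.integral_rpowIntegrand₀₁_eq_rpow_mul_const hs (hspec x hx), mul_comm]

/-- Matching moments force equality in the resolvent Jensen inequality almost everywhere. -/
theorem ae_integral_inv_eq (hF : F.IsBddSupport) {B : H →L[ℂ] H} (hB : 0 ≤ B)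
    (h1 : F.op (fun x => (x : ℝ)) = B) {s : ℝ} (hs : s ∈ Set.Ioo 0 1)
    (h2 : F.op (fun x => (x : ℝ) ^ s) = B ^ s) (h : H) :
    ∀ᵐ t ∂(volume.restrict (Set.Ioi (0 : ℝ))), ∫ x : ℝ≥0, (t + (x : ℝ))⁻¹ ∂F.diag h =
      (inner ℂ h (cfc (fun x : ℝ => (t + x)⁻¹) B h)).re := by
  set ν := volume.restrict (Set.Ioi (0 : ℝ)) with hν
  set κ := ∫ t in Set.Ioi 0, rpowIntegrand₀₁ s t 1 with hκ
  have hκ0 : 0 < κ := Real.integral_rpowIntegrand₀₁_one_pos hs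
  have hpow : F.IsBdd fun x => (x : ℝ) ^ s :=
    hF.isBdd ((Real.continuous_rpow_const hs.1.le).comp NNReal.continuous_coe)
  set L : ℝ → ℝ := fun t => ∫ x : ℝ≥0, rpowIntegrand₀₁ s t x ∂F.diag h with hL
  set r : ℝ → ℝ := fun t => (inner ℂ h (cfc (rpowIntegrand₀₁ s t) B h)).re with hr
  have hLr : ∀ t, 0 < t → L t ≤ r t := by
    intro t ht
    rw [hL, hr]
    simp only
    rw [(integral_rpowIntegrand₀₁_diag hF hs ht h).2, re_inner_cfc_rpowIntegrand₀₁ hB hs ht]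
    have := mul_le_mul_of_nonneg_left (re_inner_cfc_inv_le hF hB h1 ht h)
      (Real.rpow_nonneg ht.le s)
    linarith
  have hL0 : ∀ t, 0 < t → 0 ≤ L t := fun t ht =>
    integral_nonneg fun x => Real.rpowIntegrand₀₁_nonneg hs.1 ht.le x.2
  have hBs : (inner ℂ h ((B ^ s) h)).re = ∫ x : ℝ≥0, (x : ℝ) ^ s ∂F.diag h := by
    rw [← h2, hpow.inner_op, Complex.ofReal_re]
  obtain ⟨hint, hcfc⟩ := integral_cfc_rpowIntegrand₀₁ hB hs
  -- The real functional `S ↦ Re ⟨S h, h⟩` is continuous and so commutes with the Bochner integral.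
  let ev : (H →L[ℂ] H) →L[ℝ] ℝ := Complex.reCLM.comp
    (((innerSL ℂ h).comp (ContinuousLinearMap.apply ℂ H h)).restrictScalars ℝ)
  have hrint : Integrable r ν := ev.integrable_comp hint
  have hrval : ∫ t, r t ∂ν = κ * ∫ x : ℝ≥0, (x : ℝ) ^ s ∂F.diag h := by
    have := ev.integral_comp_comm hint
    rw [hcfc, map_smul, smul_eq_mul] at this
    rw [← hBs]
    exact this
  -- By Tonelli both integrals equal `κ` times the `s`-th moment. Together with `L ≤ r` and
  -- finiteness this gives `L = r` almost everywhere.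
  have hlin : ∫⁻ t, ENNReal.ofReal (r t) ∂ν = ∫⁻ t, ENNReal.ofReal (L t) ∂ν := by
    have hr0 : 0 ≤ᵐ[ν] r := by
      filter_upwards [ae_restrict_mem measurableSet_Ioi] with t ht
      exact (hL0 t ht).trans (hLr t ht)
    have e1 : ∫⁻ t, ENNReal.ofReal (L t) ∂ν =
        ∫⁻ t, ∫⁻ x : ℝ≥0, ENNReal.ofReal (rpowIntegrand₀₁ s t x) ∂F.diag h ∂ν := by
      refine lintegral_congr_ae ?_
      filter_upwards [ae_restrict_mem measurableSet_Ioi] with t ht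
      exact ofReal_integral_eq_lintegral_ofReal (integral_rpowIntegrand₀₁_diag hF hs ht h).1
        (ae_of_all _ fun x => Real.rpowIntegrand₀₁_nonneg hs.1 (le_of_lt ht) x.2)
    have hmeas : Measurable (Function.uncurry fun (t : ℝ) (x : ℝ≥0) =>
        ENNReal.ofReal (rpowIntegrand₀₁ s t x)) := by
      unfold rpowIntegrand₀₁ Function.uncurry
      fun_prop
    have e2 : ∀ x : ℝ≥0, ∫⁻ t, ENNReal.ofReal (rpowIntegrand₀₁ s t x) ∂ν =
        ENNReal.ofReal (κ * (x : ℝ) ^ s) := by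
      intro x
      rw [mul_comm, hκ, ← Real.integral_rpowIntegrand₀₁_eq_rpow_mul_const hs x.coe_nonneg,
        ofReal_integral_eq_lintegral_ofReal
          (Real.integrableOn_rpowIntegrand₀₁_Ioi hs x.coe_nonneg)]
      filter_upwards [ae_restrict_mem measurableSet_Ioi] with t ht
      exact Real.rpowIntegrand₀₁_nonneg hs.1 (le_of_lt ht) x.2
    rw [← ofReal_integral_eq_lintegral_ofReal hrint hr0, hrval, e1,
      lintegral_lintegral_swap hmeas.aemeasurable]
    simp_rw [e2]
    rw [← integral_const_mul, ofReal_integral_eq_lintegral_ofReal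
      ((hpow.integrable h).const_mul κ)
      (ae_of_all _ fun x => mul_nonneg hκ0.le (Real.rpow_nonneg x.2 s))]
  have hfinite : ∫⁻ t, ENNReal.ofReal (L t) ∂ν ≠ ∞ := by
    rw [← hlin]
    exact hrint.lintegral_lt_top.ne
  have hae := ae_eq_of_ae_le_of_lintegral_le (μ := ν) (f := fun t => ENNReal.ofReal (L t))
    (g := fun t => ENNReal.ofReal (r t)) (by
      filter_upwards [ae_restrict_mem measurableSet_Ioi] with t ht
      exact ENNReal.ofReal_le_ofReal (hLr t ht)) hfinite hrint.1.aemeasurable.ennreal_ofReal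
    hlin.le
  filter_upwards [hae, ae_restrict_mem measurableSet_Ioi] with t ht ht0
  have ht0 : 0 < t := ht0
  have e : L t = r t :=
    (ENNReal.ofReal_eq_ofReal_iff (hL0 t ht0) ((hL0 t ht0).trans (hLr t ht0))).mp ht
  rw [hL, hr] at e
  simp only at e
  rw [(integral_rpowIntegrand₀₁_diag hF hs ht0 h).2,
    re_inner_cfc_rpowIntegrand₀₁ hB hs ht0] at e
  have : 0 < t ^ s := Real.rpow_pos_of_pos ht0 s
  exact mul_left_cancel₀ this.ne' (by linarith)

end SemispectralMeasure

/-! ### Change of variable and the two-moment criterion. -/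

namespace SemispectralMeasure

section Map

variable {X Y : Type*} [MeasurableSpace X] [MeasurableSpace Y] {H : Type*}
  [NormedAddCommGroup H] [InnerProductSpace ℂ H] {F : SemispectralMeasure X H}

variable (F) in
/-- The image of a semispectral measure under a measurable map. -/
def map (φ : X → Y) (hφ : Measurable φ) : SemispectralMeasure Y H where
  toFun Δ := F (φ ⁻¹' Δ)
  nonneg' h Δ hΔ := F.nonneg' h _ (hφ hΔ)
  hasSum_iUnion' h Δ hΔ hd := by
    rw [Set.preimage_iUnion]
    exact F.hasSum_iUnion' h _ (fun i => hφ (hΔ i)) fun i j hij => (hd hij).preimage φ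
  univ' := F.univ'

theorem diag_map {φ : X → Y} (hφ : Measurable φ) (h : H) :
    (F.map φ hφ).diag h = (F.diag h).map φ := by
  ext Δ hΔ
  rw [Measure.map_apply hφ hΔ, diag_apply _ _ hΔ, diag_apply _ _ (hφ hΔ)]
  rfl

theorem IsBdd.comp {φ : X → Y} {hφ : Measurable φ} {f : Y → ℝ} (hf : (F.map φ hφ).IsBdd f) :
    F.IsBdd fun x => f (φ x) := by
  obtain ⟨hf, M, hM⟩ := hf
  refine ⟨hf.comp hφ, M, fun h => ?_⟩
  have := hM h
  rw [diag_map] at this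
  exact ae_of_ae_map hφ.aemeasurable this

theorem op_map [CompleteSpace H] {φ : X → Y} {hφ : Measurable φ} {f : Y → ℝ}
    (hf : (F.map φ hφ).IsBdd f) : (F.map φ hφ).op f = F.op fun x => f (φ x) :=
  hf.op_eq fun h => by
    rw [hf.comp.inner_op, diag_map, integral_map hφ.aemeasurable hf.1.aestronglyMeasurable]

end Map

variable {H : Type*} [NormedAddCommGroup H] [InnerProductSpace ℂ H]
  {F : SemispectralMeasure ℝ≥0 H}

theorem IsBddSupport.map (hF : F.IsBddSupport) {φ : ℝ≥0 → ℝ≥0} (hφ : Continuous φ) :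
    (F.map φ hφ.measurable).IsBddSupport := by
  obtain ⟨-, M, hM⟩ := hF.isBdd (NNReal.continuous_coe.comp hφ)
  refine ⟨M, fun h => ?_⟩
  rw [diag_map, ae_map_iff hφ.measurable.aemeasurable
    (measurableSet_le NNReal.continuous_coe.measurable measurable_const)]
  filter_upwards [hM h] with x hx using (le_abs_self _).trans hx

theorem IsBddSupport.isBdd_rpow (hF : F.IsBddSupport) {p : ℝ} (hp : 0 ≤ p) :
    F.IsBdd fun x => (x : ℝ) ^ p :=
  hF.isBdd ((Real.continuous_rpow_const hp).comp NNReal.continuous_coe)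

theorem re_inner_le_of_le {S T : H →L[ℂ] H} (hST : S ≤ T) (h : H) :
    (inner ℂ h (S h)).re ≤ (inner ℂ h (T h)).re := by
  have h0 : (T - S).IsPositive := (ContinuousLinearMap.le_def S T).mp hST
  have := (Complex.nonneg_iff.mp (h0.inner_nonneg_right h)).1
  rw [sub_apply, inner_sub_right, Complex.sub_re] at this
  linarith

/-- The difference of the integrands is `(t - 1) / ((1 + x) (t + x))`, with denominator at least
`1`. -/
theorem integral_inv_one_add_le (hF : F.IsBddSupport) {t ε : ℝ} (ht : 1 ≤ t) (hε : t ≤ 1 + ε)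
    (h : H) : ∫ x : ℝ≥0, (1 + (x : ℝ))⁻¹ ∂F.diag h ≤
      ∫ x : ℝ≥0, (t + (x : ℝ))⁻¹ ∂F.diag h + ε * ‖h‖ ^ 2 := by
  have hb : ∀ {t : ℝ}, 0 < t → Integrable (fun x : ℝ≥0 => (t + (x : ℝ))⁻¹) (F.diag h) :=
    fun ht => (hF.isBdd (continuous_inv_add ht)).integrable h
  have ht0 : 0 < t := one_pos.trans_le ht
  calc _ ≤ ∫ x : ℝ≥0, ((t + (x : ℝ))⁻¹ + ε) ∂F.diag h := by
        refine integral_mono (hb one_pos) ((hb ht0).add (integrable_const ε)) fun x => ?_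
        have hx : (0 : ℝ) ≤ x := x.2
        have p1 : 0 < 1 + (x : ℝ) := by linarith
        have p2 : 0 < t + (x : ℝ) := by linarith
        have e : (1 + (x : ℝ))⁻¹ - (t + (x : ℝ))⁻¹ = (t - 1) / ((1 + x) * (t + x)) := by
          field_simp
          ring
        have : (t - 1) / ((1 + (x : ℝ)) * (t + x)) ≤ ε := by
          rw [div_le_iff₀ (by positivity)]
          have : 1 ≤ (1 + (x : ℝ)) * (t + x) := by nlinarith
          nlinarith
        simp only
        linarith
    _ = _ := by
        rw [integral_add (hb ht0) (integrable_const ε), integral_const, Measure.real,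
          diag_univ, ENNReal.toReal_ofReal (by positivity), smul_eq_mul, mul_comm]

variable [CompleteSpace H]

theorem cfc_inv_add_antitone {B : H →L[ℂ] H} (hB : 0 ≤ B) {s t : ℝ} (hs : 0 < s) (hst : s ≤ t) :
    cfc (fun x : ℝ => (t + x)⁻¹) B ≤ cfc (fun x : ℝ => (s + x)⁻¹) B := by
  have hc : ∀ {t : ℝ}, 0 < t → ContinuousOn (fun x : ℝ => (t + x)⁻¹) (spectrum ℝ B) :=
    fun ht => ContinuousOn.inv₀ (by fun_prop) fun x hx =>
      (add_pos_of_pos_of_nonneg ht (spectrum_nonneg_of_nonneg hB hx)).ne'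
  refine cfc_mono (fun x hx => ?_) (hc (hs.trans_le hst)) (hc hs)
  have hx := spectrum_nonneg_of_nonneg hB hx
  exact inv_anti₀ (by linarith) (by linarith)

/-- Matching the first and the `s`-th moments forces equality for the resolvent function. -/
theorem op_inv_one_add_eq (hF : F.IsBddSupport) {B : H →L[ℂ] H} (hB : 0 ≤ B)
    (h1 : F.op (fun x => (x : ℝ)) = B) {s : ℝ} (hs : s ∈ Set.Ioo 0 1)
    (h2 : F.op (fun x => (x : ℝ) ^ s) = B ^ s) :
    F.op (fun x : ℝ≥0 => (1 + (x : ℝ))⁻¹) = cfc (fun x : ℝ => (1 + x)⁻¹) B := by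
  have hsa : IsSelfAdjoint (cfc (fun x : ℝ => (1 + x)⁻¹) B) := cfc_predicate _ B
  refine (hF.isBdd (continuous_inv_add one_pos)).op_eq fun h => ?_
  have him : (inner ℂ h (cfc (fun x : ℝ => (1 + x)⁻¹) B h)).im = 0 := by
    rw [← Complex.conj_eq_iff_im, inner_conj_symm,
      ← ContinuousLinearMap.adjoint_inner_right, hsa.adjoint_eq]
  refine Complex.ext ?_ (by rw [him, Complex.ofReal_im])
  rw [Complex.ofReal_re]
  refine le_antisymm (re_inner_cfc_inv_le hF hB h1 one_pos h) ?_
  have key : ∀ ε : ℝ, 0 < ε → ∫ x : ℝ≥0, (1 + (x : ℝ))⁻¹ ∂F.diag h ≤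
      (inner ℂ h (cfc (fun x : ℝ => (1 + x)⁻¹) B h)).re + ε * ‖h‖ ^ 2 := by
    intro ε hε
    -- The exceptional null set of `t` depends on `h`, so a value common to all `h` is reached by a
    -- limit: good `t` exist in every `(1, 1 + ε)`.
    have hne : NeBot (ae (volume.restrict (Set.Ioo (1 : ℝ) (1 + ε)))) := by
      rw [ae_neBot, Ne, Measure.restrict_eq_zero, Real.volume_Ioo]
      simpa using hε
    obtain ⟨t, ht, ht1, ht2⟩ := ((ae_restrict_of_ae_restrict_of_subset
      (fun x hx => one_pos.trans hx.1) (ae_integral_inv_eq hF hB h1 hs h2 h)).and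
      (ae_restrict_mem (measurableSet_Ioo (a := (1 : ℝ)) (b := 1 + ε)))).exists
    have ht0 : 0 < t := one_pos.trans ht1
    have i1 := integral_inv_one_add_le hF ht1.le ht2.le h
    rw [ht] at i1
    linarith [re_inner_le_of_le (cfc_inv_add_antitone hB one_pos ht1.le) h]
  refine le_of_forall_pos_le_add fun ε hε => ?_
  refine (key (ε / (‖h‖ ^ 2 + 1)) (by positivity)).trans ?_
  gcongr
  rw [div_mul_eq_mul_div, div_le_iff₀ (by positivity)]
  nlinarith

/-- A semispectral measure with two suitable moments is spectral. -/
theorem isSpectral_of_op_rpow (hF : F.IsBddSupport) {B : H →L[ℂ] H} (hB : 0 ≤ B)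
    (h1 : F.op (fun x => (x : ℝ)) = B) {s : ℝ} (hs : s ∈ Set.Ioo 0 1)
    (h2 : F.op (fun x => (x : ℝ) ^ s) = B ^ s) : F.IsSpectral :=
  isSpectral_of_op_mul hF hB fun _ hf =>
    op_mul_coe_of_op_inv_eq hF hB h1 one_pos (op_inv_one_add_eq hF hB h1 hs h2) hf

/-- The substitution `x ↦ x ^ β` sends the exponents `α < β` to `α / β < 1` and `1`. It is
invertible on `ℝ≥0`, so projections transfer back. -/
theorem isSpectralMeasureOf_of_op_rpow (hF : F.IsBddSupport) {T : H →L[ℂ] H} (hT : 0 ≤ T)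
    {α β : ℝ} (hα : 0 < α) (hαβ : α < β) (h1 : F.op (fun x => (x : ℝ) ^ α) = T ^ α)
    (h2 : F.op (fun x => (x : ℝ) ^ β) = T ^ β) : F.IsSpectralMeasureOf T := by
  have hβ : 0 < β := hα.trans hαβ
  have hφ : Continuous fun x : ℝ≥0 => x ^ β := NNReal.continuous_rpow_const hβ.le
  set G := F.map _ hφ.measurable with hG
  have hGs : G.IsBddSupport := hF.map hφ
  have hB : 0 ≤ T ^ β := CFC.rpow_nonneg
  have hop : ∀ p, 0 ≤ p → G.op (fun x => (x : ℝ) ^ p) = F.op fun x => (x : ℝ) ^ (β * p) := by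
    intro p hp
    rw [op_map (hGs.isBdd_rpow hp)]
    simp_rw [NNReal.coe_rpow, ← Real.rpow_mul (NNReal.coe_nonneg _)]
  have m1 : G.op (fun x => (x : ℝ)) = T ^ β := by
    simpa [h2] using hop 1 zero_le_one
  have m2 : G.op (fun x => (x : ℝ) ^ (α / β)) = (T ^ β) ^ (α / β) := by
    rw [hop _ (by positivity), CFC.rpow_rpow_of_exponent_nonneg _ _ _ hβ.le (by positivity) hT,
      mul_div_cancel₀ _ hβ.ne', h1]
  have hspec : G.IsSpectral :=
    isSpectral_of_op_rpow hGs hB m1 ⟨by positivity, (div_lt_one hβ).mpr hαβ⟩ m2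
  constructor
  · intro Δ hΔ
    -- The preimage of `Δ` under `x ↦ x ^ β⁻¹` is a Borel set on which `G` takes the value `F Δ`.
    have hψ : Measurable fun x : ℝ≥0 => x ^ β⁻¹ := by fun_prop
    have := hspec _ (hψ hΔ)
    convert this using 1
    change F Δ = F _
    congr 1
    ext x
    simp [← NNReal.rpow_mul, hβ.ne']
  · refine (hF.isBdd NNReal.continuous_coe).hasIntegral_iff.mpr ?_
    -- Since `G` is spectral, all its integer moments are powers of `T ^ β`; the moment of order
    -- `β⁻¹` then recovers `T`.
    have hpow : ∀ n : ℕ, G.op (fun x => (x : ℝ) ^ n) = (T ^ β) ^ n := fun n => by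
      rw [hspec.op_pow hGs, m1]
    have := op_rpow hGs hB hpow (inv_nonneg.mpr hβ.le)
    rw [hop _ (by positivity), CFC.rpow_rpow_of_exponent_nonneg _ _ _ hβ.le (by positivity) hT,
      mul_inv_cancel₀ hβ.ne', CFC.rpow_one T] at this
    simpa using this

end SemispectralMeasure

theorem theorem4p2 {H : Type*} [NormedAddCommGroup H] [InnerProductSpace ℂ H] [CompleteSpace H]
    (T : H →L[ℂ] H) (hT : T.IsPositive)
    (α β : ℝ) (hα : 0 < α) (hβ : 0 < β) (hαβ : α ≠ β)
    (F : SemispectralMeasure ℝ≥0 H) (hF : F.HasCompactSupport) :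
    List.TFAE [
      F.IsSpectralMeasureOf T,
      ∀ n : ℕ, F.HasIntegral (fun x => (((x : ℝ) ^ n : ℝ) : ℂ)) (T ^ n),
      ∀ p : ℝ, 0 ≤ p → F.HasIntegral (fun x => (((x : ℝ) ^ p : ℝ) : ℂ)) (T ^ p),
      ∀ p : ℝ, p = α ∨ p = β → F.HasIntegral (fun x => (((x : ℝ) ^ p : ℝ) : ℂ)) (T ^ p)] := by
  have hT0 : 0 ≤ T := (ContinuousLinearMap.nonneg_iff_isPositive T).mpr hT
  have hS := hF.isBddSupport
  have hcoe : F.IsBdd fun x => (x : ℝ) := hS.isBdd NNReal.continuous_coe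
  tfae_have 1 → 2 := fun ⟨hspec, hint⟩ n => by
    rw [(hcoe.pow n).hasIntegral_iff, hspec.op_pow hS, hcoe.hasIntegral_iff.mp hint]
  tfae_have 2 → 3 := fun h p hp =>
    (hS.isBdd_rpow hp).hasIntegral_iff.mpr (SemispectralMeasure.op_rpow hS hT0
      (fun n => (hcoe.pow n).hasIntegral_iff.mp (h n)) hp)
  tfae_have 3 → 4 := by
    rintro h p (rfl | rfl)
    exacts [h _ hα.le, h _ hβ.le]
  tfae_have 4 → 1 := fun h => by
    have h1 := (hS.isBdd_rpow hα.le).hasIntegral_iff.mp (h α (Or.inl rfl))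
    have h2 := (hS.isBdd_rpow hβ.le).hasIntegral_iff.mp (h β (Or.inr rfl))
    rcases lt_or_gt_of_ne hαβ with hlt | hlt
    · exact SemispectralMeasure.isSpectralMeasureOf_of_op_rpow hS hT0 hα hlt h1 h2
    · exact SemispectralMeasure.isSpectralMeasureOf_of_op_rpow hS hT0 hβ hlt h2 h1
  tfae_finish
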